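/- Let $M_t,M_r,T$ be positive integers with $T\ge M_t$, let $M=M_tM_r$, and let $\rho>0$, $\sigma^2\ge 0$. Let $\boldsymbol X\in\mathbb C^{T\times M_t}$ be a pilot matrix with $\boldsymbol X^H\boldsymbol X=\frac{T}{M_t}\boldsymbol I$, and let $\tilde{\boldsymbol C}_0\neq\tilde{\boldsymbol C}_1$ be positive definite $M\times M$ Hermitian matrices. For a change time $\nu\in\{1,2,\dots\}\cup\{\infty\}$, let the channels $\boldsymbol H_j\in\mathbb C^{M_t\times M_r}$ and the noises $\boldsymbol N_j\in\mathbb C^{T\times M_r}$, $j=1,2,\dots$, be jointly independent with $\mathrm{vec}(\boldsymbol H_j)\sim\mathcal{CN}(\boldsymbol 0,\tilde{\boldsymbol C}_0)$ for $j<\nu$, $\mathrm{vec}(\boldsymbol H_j)\sim\mathcal{CN}(\boldsymbol 0,\tilde{\boldsymbol C}_1)$ for $j\ge\nu$, and $\mathrm{vec}(\boldsymbol N_j)\sim\mathcal{CN}(\boldsymbol 0,\sigma^2\boldsymbol I)$ for all $j$; write $P_\nu$, $E_\nu$ for the corresponding probability and expectation. The received signals are $\boldsymbol Y_j=\sqrt\rho\,\boldsymbol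 X\boldsymbol H_j+\boldsymbol N_j$, and the channel estimates are $\bar{\boldsymbol h}_j=\mathrm{vec}\big(\frac{M_t}{\sqrt\rho\,T}\boldsymbol X^H\boldsymbol Y_j\big)$. Put $E_0=\rho T/M_t$, $\boldsymbol A_i=\tilde{\boldsymbol C}_i+\frac{\sigma^2}{E_0}\boldsymbol I$ and $$p_i(\boldsymbol h)=\frac{\exp(-\boldsymbol h^H\boldsymbol A_i^{-1}\boldsymbol h)}{\pi^M|\boldsymbol A_i|},\qquad i=0,1.$$ The genie-aided CUSUM detector with threshold $\theta$ declares a change at the time $$j(\theta)=\min\{j\ge 1: W_j>\theta\},\qquad W_j=\max_{1\le p\le j}\ \sum_{k=p}^{j}\big(\log p_1(\bar{\boldsymbol h}_k)-\log p_0(\bar{\boldsymbol h}_k)\big),$$ with $j(\theta)=\infty$ if there is no such $j$. Its false alarm rate and conditional average detection delay are $$R_F(\theta)=\frac{1}{E_\infty\{j(\theta)\mid j(\theta)<\infty\}},\qquad T_C(\theta)=\max_{\nu\in\{1,2,\dots\}}E_\nu\{j(\theta)-\nu\mid j(\theta)\ge\nu\}.$$ Then for every $\theta\ge 0$ one has $P_\infty(j(\theta)<\infty)=1$,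 $R_F(\theta)>0$ and $T_C(\theta)<\infty$, the maximum being attained, and $$\lim_{\theta\to\infty}\frac{T_C(\theta)}{-\log R_F(\theta)}=\frac{1}{\Phi(\boldsymbol A_1,\boldsymbol A_0)},\qquad \Phi(\boldsymbol A,\boldsymbol B)=-M-\log|\boldsymbol A\boldsymbol B^{-1}|+\mathrm{tr}(\boldsymbol A\boldsymbol B^{-1}).$$ -/

import Mathlib

open MeasureTheory ProbabilityTheory Matrix Filter Topology
open scoped ENNReal NNReal ComplexOrder MatrixOrder

noncomputable section

namespace ChannelChange

/-- The standard circularly symmetric complex Gaussian law on `ℂ`: independent real and imaginary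
parts, each of mean `0` and variance `1/2`. -/
def stdComplexGaussian : Measure ℂ :=
  ((gaussianReal 0 (1 / 2)).prod (gaussianReal 0 (1 / 2))).map (fun x : ℝ × ℝ => ⟨x.1, x.2⟩)

/-- The circularly symmetric complex Gaussian law `𝒞𝒩(0, C)` on `ℂ^ι` with positive semidefinite
covariance matrix `C`: the law of `C^{1/2} z`, where the entries of `z` are independent and
standard complex Gaussian. -/
def complexGaussian {ι : Type*} [Fintype ι] [DecidableEq ι] (C : Matrix ι ι ℂ) :
    Measure (ι → ℂ) :=
  (Measure.pi fun _ : ι => stdComplexGaussian).map (fun z => CFC.sqrt C *ᵥ z)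

/-- The probability density `exp (-hᴴ A⁻¹ h) / (π ^ M |A|)` of `𝒞𝒩(0, A)`, for `A` positive
definite of size `M`. -/
def gaussianDensity {ι : Type*} [Fintype ι] [DecidableEq ι] (A : Matrix ι ι ℂ) (h : ι → ℂ) : ℝ :=
  Real.exp (-(star h ⬝ᵥ (A⁻¹ *ᵥ h)).re) / (Real.pi ^ Fintype.card ι * A.det.re)

/-- The log-likelihood ratio `log p(h | A₁) - log p(h | A₀)`. -/
def llr {ι : Type*} [Fintype ι] [DecidableEq ι] (A₀ A₁ : Matrix ι ι ℂ) (h : ι → ℂ) : ℝ :=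
  Real.log (gaussianDensity A₁ h) - Real.log (gaussianDensity A₀ h)

/-- The log-determinant divergence `Φ(A, B) = -M - log |A B⁻¹| + tr (A B⁻¹)`. -/
def logDetDiv {ι : Type*} [Fintype ι] [DecidableEq ι] (A B : Matrix ι ι ℂ) : ℝ :=
  -(Fintype.card ι : ℝ) - Real.log (A * B⁻¹).det.re + (A * B⁻¹).trace.re

section Detector

variable {ι : Type*} [Fintype ι] [DecidableEq ι]

/-- The CUSUM statistic at time `j`: the maximum over `1 ≤ p ≤ j` of the sum of the log-likelihood
ratios of the observations `h p, …, h j`. -/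
def cusum (A₀ A₁ : Matrix ι ι ℂ) (h : ℕ+ → ι → ℂ) (j : ℕ+) : ℝ :=
  (Finset.Icc 1 j).sup' (Finset.nonempty_Icc.2 one_le)
    (fun p => ∑ i ∈ Finset.Icc p j, llr A₀ A₁ (h i))

/-- The time at which a change is declared: the least `j ≥ 1` with CUSUM statistic above `θ`, and
`∞` if there is none. -/
def alarmTime (A₀ A₁ : Matrix ι ι ℂ) (θ : ℝ) (h : ℕ+ → ι → ℂ) : ℕ∞ :=
  ⨅ (j : ℕ+) (_ : θ < cusum A₀ A₁ h j), ((j : ℕ) : ℕ∞)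

variable {Ω : Type*} [MeasurableSpace Ω]

/-- The false alarm rate of a random alarm time `τ`, where `P ⊤` is the probability when a change
never occurs: `1 / E_∞[τ | τ < ∞]`. -/
def falseAlarmRate (P : WithTop ℕ+ → Measure Ω) (τ : Ω → ℕ∞) : ℝ≥0∞ :=
  (∫⁻ ω, (τ ω : ℝ≥0∞) ∂(ProbabilityTheory.cond (P ⊤) {ω | τ ω < ⊤}))⁻¹

/-- The average detection delay `E_ν[τ - ν | τ ≥ ν]` of a random alarm time `τ` for the change
time `ν`, where `P ν` is the probability when the change occurs at time `ν`. -/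
def delayAt (P : WithTop ℕ+ → Measure Ω) (τ : Ω → ℕ∞) (ν : ℕ+) : ℝ≥0∞ :=
  ∫⁻ ω, ((τ ω : ℝ≥0∞) - ((ν : ℕ) : ℝ≥0∞))
    ∂(ProbabilityTheory.cond (P ν) {ω | ((ν : ℕ) : ℕ∞) ≤ τ ω})

/-- The conditional average detection delay: the worst case over the change time `ν ≥ 1`. -/
def condAvgDelay (P : WithTop ℕ+ → Measure Ω) (τ : Ω → ℕ∞) : ℝ≥0∞ :=
  ⨆ ν : ℕ+, delayAt P τ ν

end Detector

section Channel

variable {Mt Mr T : ℕ}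

/-- The received pilot signal `Y = √ρ X H + N`. -/
def received (ρ : ℝ) (X : Matrix (Fin T) (Fin Mt) ℂ) (H : Matrix (Fin Mt) (Fin Mr) ℂ)
    (N : Matrix (Fin T) (Fin Mr) ℂ) : Matrix (Fin T) (Fin Mr) ℂ :=
  (Real.sqrt ρ : ℂ) • (X * H) + N

/-- The vectorized maximum likelihood channel estimate `vec (M_t / (√ρ T) Xᴴ Y)`. -/
def channelEstimate (ρ : ℝ) (X : Matrix (Fin T) (Fin Mt) ℂ) (Y : Matrix (Fin T) (Fin Mr) ℂ) :
    Fin Mr × Fin Mt → ℂ :=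
  (((Mt : ℂ) / ((Real.sqrt ρ : ℂ) * (T : ℂ))) • (Xᴴ * Y)).vec

/-- `E₀ = ρ T / M_t`; the noise in the channel estimate has covariance `(σ² / E₀) I`. -/
def pilotEnergy (ρ : ℝ) (T Mt : ℕ) : ℝ := ρ * T / Mt

/-- The covariance matrix `C + (σ² / E₀) I` of the channel estimate. -/
def estimateCov (ρ σ : ℝ) (T : ℕ) (C : Matrix (Fin Mr × Fin Mt) (Fin Mr × Fin Mt) ℂ) :
    Matrix (Fin Mr × Fin Mt) (Fin Mr × Fin Mt) ℂ :=
  C + ((σ ^ 2 / pilotEnergy ρ T Mt : ℝ) : ℂ) • 1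

/-- The alarm time `j(θ)` of the genie-aided CUSUM detector with threshold `θ`, which knows `C₀` and
`C₁` and observes the channel estimates. -/
def genieAlarmTime {Ω : Type*} (ρ σ : ℝ) (X : Matrix (Fin T) (Fin Mt) ℂ)
    (C₀ C₁ : Matrix (Fin Mr × Fin Mt) (Fin Mr × Fin Mt) ℂ)
    (H : ℕ+ → Ω → Matrix (Fin Mt) (Fin Mr) ℂ) (N : ℕ+ → Ω → Matrix (Fin T) (Fin Mr) ℂ)
    (θ : ℝ) (ω : Ω) : ℕ∞ :=
  alarmTime (estimateCov ρ σ T C₀) (estimateCov ρ σ T C₁) θ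
    (fun j => channelEstimate ρ X (received ρ X (H j ω) (N j ω)))

end Channel

end ChannelChange

end

/-! By orthogonality of the pilot, the channel estimate is `vec H` plus a linear image of `vec N`,
hence Gaussian with covariance `A₀` before the change and `A₁` after it. The detector uses only its
log-likelihood ratios `x k`, which are independent with law `μ₀` before the change and `μ₁ = e^y μ₀`
after it. The mean of `μ₁` is the Kullback–Leibler divergence Φ = `logDetDiv A₁ A₀`, positive
because `A₁ ≠ A₀`. What remains is Lorden's asymptotics for CUSUM, with τ the alarm time and S_n the
sum of the first n ratios.

The worst change time is ν = 1: earlier samples can only hasten the alarm, and the later ones are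
independent of the conditioning event (`delayAt_succPNat_le`). So T_C = E₁τ - 1, while -log R_F =
log E_∞τ. It suffices that E₁τ ~ θ/Φ and log E_∞τ ~ θ.

Upper bounds: each block of n samples with sum above θ forces an alarm, so Eτ ≤ n / P(S_n > θ)
(`IsIID.tsum_measure_quiet_le`). Take n slightly above θ/Φ. Under P₁ the probability tends to 1 by
the law of large numbers; under P_∞ a change of measure bounds it below by e^{-dθ}/2 with d close to
1.

Lower bounds: the Shiryaev–Roberts statistic R_n minus n is a martingale under P_∞ and R ≥ e^θ at
the alarm, so E_∞τ ≥ e^θ (`IsIID.exp_le_tsum_measure_quiet`). The same argument gives P_∞(τ ≤ n) ≤ n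
e^{-θ}. For n slightly below θ/Φ, transferring this to P₁ costs a factor e^{cθ} with c < 1, so an
alarm by time n is unlikely under P₁ as well. -/

namespace ChannelChange

/-! ### Densities of complex Gaussian laws and their likelihood ratio. -/

section Density

lemma map_withDensity_comp {α β : Type*} [MeasurableSpace α] [MeasurableSpace β] {μ : Measure α}
    {g : α → β} (hg : Measurable g) {f : β → ℝ≥0∞} (hf : Measurable f) :
    (μ.withDensity (fun a => f (g a))).map g = (μ.map g).withDensity f := by
  ext s hs
  rw [Measure.map_apply hg hs, withDensity_apply _ (hg hs), withDensity_apply _ hs,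
    setLIntegral_map hs hf hg]

lemma lintegral_pi_prod {ι : Type*} [Fintype ι] {α : ι → Type*} [∀ i, MeasurableSpace (α i)]
    (μ : ∀ i, Measure (α i)) [∀ i, IsProbabilityMeasure (μ i)] {f : ∀ i, α i → ℝ≥0∞}
    (hf : ∀ i, Measurable (f i)) :
    ∫⁻ x, ∏ i, f i (x i) ∂(Measure.pi μ) = ∏ i, ∫⁻ a, f i a ∂(μ i) := by
  refine (lintegral_prod_eq_prod_lintegral_of_indepFun Finset.univ (fun i (x : ∀ i, α i) => f i (x i))
    (iIndepFun_pi fun i => (hf i).aemeasurable)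
    (fun i => (hf i).comp (measurable_pi_apply i))).trans ?_
  refine Finset.prod_congr rfl fun i _ => ?_
  exact (measurePreserving_eval μ i).lintegral_comp (hf i)

lemma pi_withDensity {ι : Type*} [Fintype ι] {α : ι → Type*} [∀ i, MeasurableSpace (α i)]
    (μ : ∀ i, Measure (α i)) [∀ i, IsProbabilityMeasure (μ i)] {f : ∀ i, α i → ℝ≥0∞}
    (hf : ∀ i, Measurable (f i)) [∀ i, SigmaFinite ((μ i).withDensity (f i))] :
    Measure.pi (fun i => (μ i).withDensity (f i)) =
      (Measure.pi μ).withDensity fun x => ∏ i, f i (x i) := by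
  refine Measure.pi_eq fun s hs => ?_
  rw [withDensity_apply _ (MeasurableSet.univ_pi hs), ← lintegral_indicator (MeasurableSet.univ_pi hs)]
  have h : ∀ x : ∀ i, α i, (Set.univ.pi s).indicator (fun x => ∏ i, f i (x i)) x =
      ∏ i, (s i).indicator (f i) (x i) := by
    intro x
    by_cases hx : x ∈ Set.univ.pi s
    · rw [Set.indicator_of_mem hx]
      exact Finset.prod_congr rfl fun i _ => (Set.indicator_of_mem (hx i trivial) _).symm
    · rw [Set.indicator_of_notMem hx]
      simp only [Set.mem_pi, Set.mem_univ, true_imp_iff, not_forall] at hx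
      obtain ⟨i, hi⟩ := hx
      exact (Finset.prod_eq_zero (Finset.mem_univ i) (Set.indicator_of_notMem hi _)).symm
  simp_rw [h]
  rw [lintegral_pi_prod μ fun i => (hf i).indicator (hs i)]
  refine Finset.prod_congr rfl fun i _ => ?_
  rw [withDensity_apply _ (hs i), lintegral_indicator (hs i)]

instance : IsProbabilityMeasure stdComplexGaussian :=
  Measure.isProbabilityMeasure_map
    (Complex.measurableEquivRealProd.symm.measurable.aemeasurable)

lemma stdComplexGaussian_eq_withDensity :
    stdComplexGaussian =
      (volume : Measure ℂ).withDensity fun z => ENNReal.ofReal (Real.exp (-‖z‖ ^ 2) / Real.pi) := by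
  have hm : Measurable fun z : ℂ => ENNReal.ofReal (Real.exp (-‖z‖ ^ 2) / Real.pi) := by fun_prop
  have hv : (volume : Measure ℂ) =
      (volume : Measure (ℝ × ℝ)).map Complex.measurableEquivRealProd.symm :=
    (Complex.volume_preserving_equiv_real_prod.symm
      Complex.measurableEquivRealProd).map_eq.symm
  rw [hv, ← map_withDensity_comp Complex.measurableEquivRealProd.symm.measurable hm,
    stdComplexGaussian, gaussianReal_of_var_ne_zero 0 (by norm_num : (1 / 2 : ℝ≥0) ≠ 0),
    prod_withDensity (measurable_gaussianPDF _ _) (measurable_gaussianPDF _ _)]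
  congr 1
  rw [Measure.volume_eq_prod]
  congr 1
  ext p
  rw [gaussianPDF, gaussianPDF, ← ENNReal.ofReal_mul (gaussianPDFReal_nonneg _ _ _)]
  congr 1
  have hn : ‖Complex.measurableEquivRealProd.symm p‖ ^ 2 = p.1 ^ 2 + p.2 ^ 2 := by
    rw [← Complex.normSq_eq_norm_sq, Complex.normSq_apply]
    change p.1 * p.1 + p.2 * p.2 = _
    ring
  rw [hn, gaussianPDFReal, gaussianPDFReal]
  have hs : Real.sqrt (2 * Real.pi * ((1 / 2 : ℝ≥0) : ℝ)) = Real.sqrt Real.pi := by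
    congr 1; push_cast; ring
  rw [hs]
  have he : Real.exp (-(p.1 ^ 2 + p.2 ^ 2)) = Real.exp (-(p.1 - 0) ^ 2 / (2 * ((1 / 2 : ℝ≥0) : ℝ))) *
      Real.exp (-(p.2 - 0) ^ 2 / (2 * ((1 / 2 : ℝ≥0) : ℝ))) := by
    rw [← Real.exp_add]; congr 1; push_cast; ring
  have : Real.pi⁻¹ = (Real.sqrt Real.pi)⁻¹ * (Real.sqrt Real.pi)⁻¹ := by
    rw [← mul_inv, Real.mul_self_sqrt Real.pi_pos.le]
  rw [he, div_eq_mul_inv (_ * _), this]; ring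

/-- `pi_withDensity` has probability measures as base, so Lebesgue measure is expressed over the
Gaussian, multiplied over the coordinates, and the density inverted only afterwards. -/
lemma volume_eq_withDensity_stdComplexGaussian :
    (volume : Measure ℂ) = stdComplexGaussian.withDensity
      fun z => (ENNReal.ofReal (Real.exp (-‖z‖ ^ 2) / Real.pi))⁻¹ := by
  rw [stdComplexGaussian_eq_withDensity, withDensity_inv_same (by fun_prop)]
  · refine .of_forall fun z => ?_
    have : 0 < Real.exp (-‖z‖ ^ 2) / Real.pi := by positivity
    simpa using this
  · exact .of_forall fun z => ENNReal.ofReal_ne_top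

variable {ι : Type*} [Fintype ι]

lemma pi_stdComplexGaussian_eq_withDensity :
    Measure.pi (fun _ : ι => stdComplexGaussian) =
      (volume : Measure (ι → ℂ)).withDensity
        fun z => ENNReal.ofReal (Real.exp (-∑ i, ‖z i‖ ^ 2) / Real.pi ^ Fintype.card ι) := by
  have hm : Measurable fun z : ℂ => (ENNReal.ofReal (Real.exp (-‖z‖ ^ 2) / Real.pi))⁻¹ := by
    fun_prop
  have hpos : ∀ z : ℂ, 0 < Real.exp (-‖z‖ ^ 2) / Real.pi := fun z => by positivity
  have hs : SigmaFinite (stdComplexGaussian.withDensity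
      fun z => (ENNReal.ofReal (Real.exp (-‖z‖ ^ 2) / Real.pi))⁻¹) := by
    rw [← volume_eq_withDensity_stdComplexGaussian]; infer_instance
  have hv : (volume : Measure (ι → ℂ)) = (Measure.pi (fun _ : ι => stdComplexGaussian)).withDensity
      fun x => ∏ i, (ENNReal.ofReal (Real.exp (-‖x i‖ ^ 2) / Real.pi))⁻¹ := by
    rw [← pi_withDensity (fun _ : ι => stdComplexGaussian) (fun _ => hm), volume_pi]
    congr 1
    funext i
    exact volume_eq_withDensity_stdComplexGaussian
  have hprod : ∀ z : ι → ℂ,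
      ENNReal.ofReal (Real.exp (-∑ i, ‖z i‖ ^ 2) / Real.pi ^ Fintype.card ι) =
      (∏ i, (ENNReal.ofReal (Real.exp (-‖z i‖ ^ 2) / Real.pi))⁻¹)⁻¹ := by
    intro z
    rw [← ENNReal.prod_inv_distrib, inv_inv, ← ENNReal.ofReal_prod_of_nonneg
      (fun i _ => (hpos (z i)).le)]
    · congr 1
      rw [Finset.prod_div_distrib, ← Real.exp_sum, Finset.sum_neg_distrib]
      simp
    · intro i _ j _ _
      left
      simpa using hpos (z i)
  simp_rw [hprod]
  rw [hv, withDensity_inv_same]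
  · fun_prop
  · refine .of_forall fun z => ?_
    simp [Finset.prod_eq_zero_iff]
  · refine .of_forall fun z => ?_
    refine ENNReal.prod_ne_top fun i _ => ?_
    simpa using hpos (z i)

lemma measurable_mulVec {κ : Type*} [Fintype κ] (A : Matrix κ ι ℂ) :
    Measurable fun z : ι → ℂ => A *ᵥ z :=
  (Continuous.matrix_mulVec continuous_const continuous_id).measurable

variable [DecidableEq ι]

instance (C : Matrix ι ι ℂ) : IsProbabilityMeasure (complexGaussian C) :=
  Measure.isProbabilityMeasure_map (measurable_mulVec _).aemeasurable

lemma isHermitian_cfcSqrt (A : Matrix ι ι ℂ) : (CFC.sqrt A).IsHermitian :=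
  (CFC.sqrt_nonneg A).posSemidef.isHermitian

lemma normSq_det_cfcSqrt {A : Matrix ι ι ℂ} (hA : A.PosDef) :
    ((Complex.normSq (CFC.sqrt A).det : ℝ) : ℂ) = A.det := by
  rw [Complex.normSq_eq_conj_mul_self]
  change star _ * _ = _
  rw [← det_conjTranspose, (isHermitian_cfcSqrt A).eq, ← det_mul,
    CFC.sqrt_mul_sqrt_self A hA.posSemidef.nonneg]

lemma det_re_pos {A : Matrix ι ι ℂ} (hA : A.PosDef) : 0 < A.det.re :=
  (Complex.lt_def.1 hA.det_pos).1

lemma isUnit_det_cfcSqrt {A : Matrix ι ι ℂ} (hA : A.PosDef) : IsUnit (CFC.sqrt A).det := by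
  rw [isUnit_iff_ne_zero]
  intro h
  have := normSq_det_cfcSqrt hA
  rw [h] at this
  have h2 := hA.det_pos
  simp [← this] at h2

/-- The real determinant of a complex-linear map is the squared modulus of its complex determinant.
-/
lemma map_mulVec_volume {S : Matrix ι ι ℂ} (hS : S.det ≠ 0) :
    (volume : Measure (ι → ℂ)).map (fun z => S *ᵥ z) =
      ENNReal.ofReal (Complex.normSq S.det)⁻¹ • volume := by
  have hdet : LinearMap.det ((toLin' S).restrictScalars ℝ) = Complex.normSq S.det := by
    have := LinearMap.det_restrictScalars (R := ℝ) (f := toLin' S)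
    rw [LinearMap.det_toLin', Algebra.norm_complex_eq] at this
    exact this
  have h := Measure.map_linearMap_addHaar_eq_smul_addHaar (volume : Measure (ι → ℂ))
    (f := (toLin' S).restrictScalars ℝ) (by rw [hdet]; simpa using hS)
  rw [hdet, abs_of_nonneg (inv_nonneg.2 (Complex.normSq_nonneg _))] at h
  exact h

lemma measurable_gaussianDensity (A : Matrix ι ι ℂ) : Measurable (gaussianDensity A) := by
  unfold gaussianDensity dotProduct
  have := measurable_mulVec A⁻¹
  have h2 : ∀ i, Measurable fun h : ι → ℂ => (A⁻¹ *ᵥ h) i := fun i =>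
    (measurable_pi_apply i).comp this
  have h3 : ∀ i, Measurable fun h : ι → ℂ => (star h) i := fun i => by
    simp only [Pi.star_apply]
    exact (continuous_star.measurable).comp (measurable_pi_apply i)
  fun_prop

lemma gaussianDensity_pos {A : Matrix ι ι ℂ} (hA : A.PosDef) (h : ι → ℂ) :
    0 < gaussianDensity A h := by
  have := det_re_pos hA
  unfold gaussianDensity
  positivity

/-- Linear change of variables by `S = √A`: the Jacobian is `|det S|² = det A`, and the quadratic
form of `A⁻¹` at `S z` is `‖z‖²`. -/
lemma complexGaussian_eq_withDensity {A : Matrix ι ι ℂ} (hA : A.PosDef) :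
    complexGaussian A =
      (volume : Measure (ι → ℂ)).withDensity fun h => ENNReal.ofReal (gaussianDensity A h) := by
  set S := CFC.sqrt A with hSdef
  have hSu : IsUnit S.det := isUnit_det_cfcSqrt hA
  have hSH : S.IsHermitian := isHermitian_cfcSqrt A
  have hSS : S * S = A := CFC.sqrt_mul_sqrt_self A hA.posSemidef.nonneg
  have hdet : Complex.normSq S.det = A.det.re := by
    rw [← normSq_det_cfcSqrt hA]; simp [hSdef]
  have hpos := det_re_pos hA
  have hkey : ∀ z : ι → ℂ, ENNReal.ofReal (Real.exp (-∑ i, ‖z i‖ ^ 2) / Real.pi ^ Fintype.card ι) =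
      ENNReal.ofReal (A.det.re) * ENNReal.ofReal (gaussianDensity A (S *ᵥ z)) := by
    intro z
    rw [← ENNReal.ofReal_mul hpos.le]
    congr 1
    have hq : star (S *ᵥ z) ⬝ᵥ (A⁻¹ *ᵥ (S *ᵥ z)) = ((∑ i, ‖z i‖ ^ 2 : ℝ) : ℂ) := by
      rw [star_mulVec, hSH.eq, ← dotProduct_mulVec, mulVec_mulVec, mulVec_mulVec, ← hSS, Matrix.mul_inv_rev,
        Matrix.mul_assoc, Matrix.mul_assoc, Matrix.nonsing_inv_mul _ hSu, Matrix.mul_one,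
        Matrix.mul_nonsing_inv _ hSu, one_mulVec, dotProduct]
      push_cast
      refine Finset.sum_congr rfl fun i _ => ?_
      simp [← Complex.conj_mul']
    rw [gaussianDensity, hq, Complex.ofReal_re]
    field_simp
  rw [complexGaussian, pi_stdComplexGaussian_eq_withDensity]
  simp_rw [hkey]
  have hm := (measurable_gaussianDensity A).ennreal_ofReal
  rw [map_withDensity_comp (f := fun h => ENNReal.ofReal (A.det.re) * ENNReal.ofReal (gaussianDensity A h))
    (measurable_mulVec S) (hm.const_mul _), map_mulVec_volume hSu.ne_zero, hdet,
    withDensity_smul_measure]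
  change _ • volume.withDensity (ENNReal.ofReal (A.det.re) • fun h => ENNReal.ofReal (gaussianDensity A h)) = _
  rw [withDensity_smul _ hm, smul_smul, ← ENNReal.ofReal_mul (inv_nonneg.2 hpos.le),
    inv_mul_cancel₀ hpos.ne', ENNReal.ofReal_one, one_smul]

lemma measurable_llr (A₀ A₁ : Matrix ι ι ℂ) : Measurable (llr A₀ A₁) := by
  unfold llr
  exact (Real.measurable_log.comp (measurable_gaussianDensity _)).sub
    (Real.measurable_log.comp (measurable_gaussianDensity _))

lemma complexGaussian_eq_withDensity_exp_llr {A₀ A₁ : Matrix ι ι ℂ} (h₀ : A₀.PosDef)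
    (h₁ : A₁.PosDef) :
    complexGaussian A₁ =
      (complexGaussian A₀).withDensity fun h => ENNReal.ofReal (Real.exp (llr A₀ A₁ h)) := by
  rw [complexGaussian_eq_withDensity h₀, complexGaussian_eq_withDensity h₁,
    ← withDensity_mul _ (measurable_gaussianDensity _).ennreal_ofReal
      (measurable_llr _ _).exp.ennreal_ofReal]
  congr 1
  ext h
  rw [Pi.mul_apply, ← ENNReal.ofReal_mul (gaussianDensity_pos h₀ h).le, llr, Real.exp_sub,
    Real.exp_log (gaussianDensity_pos h₀ h), Real.exp_log (gaussianDensity_pos h₁ h),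
    mul_div_cancel₀ _ (gaussianDensity_pos h₀ h).ne']

end Density

/-! ### Sums of independent complex Gaussian vectors. -/

section CharacteristicFunction

lemma exists_re_dotProduct_eq {ι : Type*} [Fintype ι] (L : StrongDual ℝ (ι → ℂ)) :
    ∃ a : ι → ℂ, ∀ v, L v = (star a ⬝ᵥ v).re := by
  classical
  refine ⟨fun i => ⟨L (Pi.single i 1), L (Pi.single i Complex.I)⟩, fun v => ?_⟩
  have hv : v = ∑ i, ((v i).re • (Pi.single i (1 : ℂ) : ι → ℂ) +
      (v i).im • (Pi.single i Complex.I : ι → ℂ)) := by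
    funext j
    rw [Finset.sum_apply, Finset.sum_eq_single j]
    · simp
    · intro i _ hij
      simp [Pi.single_eq_of_ne hij.symm]
    · simp
  conv_lhs => rw [hv]
  simp [dotProduct, map_sum, map_add, map_smul, mul_comm]

lemma charFunDual_stdComplexGaussian (l : StrongDual ℝ ℂ) :
    charFunDual stdComplexGaussian l =
      Complex.exp (-((l 1 ^ 2 + l Complex.I ^ 2 : ℝ) : ℂ) / 4) := by
  have hc : stdComplexGaussian = ((gaussianReal 0 (1 / 2)).prod (gaussianReal 0 (1 / 2))).map
      (Complex.equivRealProdCLM.symm : ℝ × ℝ →L[ℝ] ℂ) := rfl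
  rw [hc, charFunDual_map, charFunDual_prod]
  rw [charFunDual_eq_charFun_map_one, charFunDual_eq_charFun_map_one]
  have key : ∀ m : StrongDual ℝ ℝ, charFun ((gaussianReal 0 (1 / 2)).map m) 1 =
      Complex.exp (-((m 1 ^ 2 : ℝ) : ℂ) / 4) := by
    intro m
    have hm : (m : ℝ → ℝ) = fun x => m 1 * x := by
      funext x
      have := m.map_smul x 1
      simpa [mul_comm] using this
    rw [hm, gaussianReal_map_const_mul, charFun_gaussianReal]
    congr 1
    simp
    ring
  rw [key, key, ← Complex.exp_add]
  congr 1
  have h1 : Complex.equivRealProdCLM.symm ((1 : ℝ), (0 : ℝ)) = 1 := by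
    apply Complex.ext <;> simp
  have h2 : Complex.equivRealProdCLM.symm ((0 : ℝ), (1 : ℝ)) = Complex.I := by
    apply Complex.ext <;> simp
  simp [h1, h2]
  ring

variable {ι κ : Type*} [Fintype ι] [DecidableEq ι] [Fintype κ] [DecidableEq κ]

/-- Characteristic functions, unlike densities, allow a singular covariance, as is needed for the
noise when σ = 0. Pulling `L` back through `S = √C` replaces `a` by `S a`, whose squared norm is `aᴴ
C a`; the factor 1/4 reflects variance 1/2 in each real coordinate. -/
lemma charFunDual_complexGaussian {C : Matrix ι ι ℂ} (hC : C.PosSemidef)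
    (L : StrongDual ℝ (ι → ℂ)) (a : ι → ℂ) (ha : ∀ v, L v = (star a ⬝ᵥ v).re) :
    charFunDual (complexGaussian C) L = Complex.exp (-(star a ⬝ᵥ (C *ᵥ a)) / 4) := by
  set S := CFC.sqrt C with hSdef
  have hSH : S.IsHermitian := isHermitian_cfcSqrt C
  have hSS : S * S = C := CFC.sqrt_mul_sqrt_self C hC.nonneg
  let F : (ι → ℂ) →L[ℝ] (ι → ℂ) :=
    ⟨(toLin' S).restrictScalars ℝ, Continuous.matrix_mulVec continuous_const continuous_id⟩
  have hF : complexGaussian C = (Measure.pi fun _ : ι => stdComplexGaussian).map F := rfl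
  rw [hF, charFunDual_map, charFunDual_pi]
  simp_rw [charFunDual_stdComplexGaussian]
  rw [← Complex.exp_sum]
  congr 1
  have hval : ∀ i (c : ℂ), (L ∘SL F) (Pi.single i c) = (star (S *ᵥ a) i * c).re := by
    intro i c
    have : F (Pi.single i c) = S *ᵥ Pi.single i c := rfl
    rw [ContinuousLinearMap.comp_apply, ha, this, dotProduct_mulVec, dotProduct_single,
      star_mulVec, hSH.eq]
  have hq : star a ⬝ᵥ (C *ᵥ a) = star (S *ᵥ a) ⬝ᵥ (S *ᵥ a) := by
    rw [← hSS, star_mulVec, hSH.eq, ← dotProduct_mulVec, mulVec_mulVec]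
  rw [hq, dotProduct, neg_div, Finset.sum_div, ← Finset.sum_neg_distrib]
  refine Finset.sum_congr rfl fun i _ => ?_
  have h1 : ((L ∘SL F) ∘SL ContinuousLinearMap.single ℝ (fun _ => ℂ) i) 1 =
    (star (S *ᵥ a) i * 1).re := hval i 1
  have h2 : ((L ∘SL F) ∘SL ContinuousLinearMap.single ℝ (fun _ => ℂ) i) Complex.I =
    (star (S *ᵥ a) i * Complex.I).re := hval i Complex.I
  rw [h1, h2, neg_div, Pi.star_apply]
  have hn : star ((S *ᵥ a) i) * (S *ᵥ a) i = (Complex.normSq ((S *ᵥ a) i) : ℂ) :=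
    Complex.normSq_eq_conj_mul_self.symm
  rw [hn, Complex.normSq_apply]
  simp
  ring

/-- The sum of a complex Gaussian vector and an independent linear image of another one. -/
lemma hasLaw_add_mulVec {Ω : Type*} [MeasurableSpace Ω] {P : Measure Ω} [IsProbabilityMeasure P]
    {U : Ω → ι → ℂ} {V : Ω → κ → ℂ} {C : Matrix ι ι ℂ} {D : Matrix κ κ ℂ} (hC : C.PosSemidef)
    (hD : D.PosSemidef) (B : Matrix ι κ ℂ) (hU : HasLaw U (complexGaussian C) P)
    (hV : HasLaw V (complexGaussian D) P) (hUV : IndepFun U V P) :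
    HasLaw (fun ω => U ω + B *ᵥ V ω) (complexGaussian (C + B * D * Bᴴ)) P := by
  let F : (κ → ℂ) →L[ℝ] (ι → ℂ) :=
    ⟨(toLin' B).restrictScalars ℝ, Continuous.matrix_mulVec continuous_const continuous_id⟩
  have hBm := measurable_mulVec B
  have hVm : AEMeasurable (fun ω => B *ᵥ V ω) P := hBm.comp_aemeasurable hV.aemeasurable
  refine ⟨hU.aemeasurable.add hVm, ?_⟩
  have : IsProbabilityMeasure (P.map fun ω => U ω + B *ᵥ V ω) :=
    Measure.isProbabilityMeasure_map (hU.aemeasurable.add hVm)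
  refine Measure.ext_of_charFunDual (funext fun L => ?_)
  obtain ⟨a, ha⟩ := exists_re_dotProduct_eq L
  have hind : IndepFun U (fun ω => B *ᵥ V ω) P := hUV.comp measurable_id hBm
  have hsum : (fun ω => U ω + B *ᵥ V ω) = U + fun ω => B *ᵥ V ω := rfl
  rw [hsum, hind.charFunDual_map_add_eq_mul hU.aemeasurable hVm, Pi.mul_apply, hU.map_eq]
  have hmap : P.map (fun ω => B *ᵥ V ω) = (complexGaussian D).map F := by
    rw [← hV.map_eq, AEMeasurable.map_map_of_aemeasurable F.measurable.aemeasurable hV.aemeasurable]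
    rfl
  rw [hmap, charFunDual_map, charFunDual_complexGaussian hC L a ha,
    charFunDual_complexGaussian hD (L ∘SL F) (Bᴴ *ᵥ a), charFunDual_complexGaussian _ L a ha,
    ← Complex.exp_add]
  · congr 1
    rw [star_mulVec, conjTranspose_conjTranspose, ← dotProduct_mulVec, mulVec_mulVec, mulVec_mulVec,
      add_mulVec, dotProduct_add, Matrix.mul_assoc]
    ring
  · exact hC.add (hD.mul_mul_conjTranspose_same B)
  · intro v
    have : F v = B *ᵥ v := rfl
    rw [ContinuousLinearMap.comp_apply, ha, this, star_mulVec, conjTranspose_conjTranspose,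
      dotProduct_mulVec]

end CharacteristicFunction

/-! ### Mean of the log-likelihood ratio and positivity of the divergence. -/

section Moments

lemma map_re_stdComplexGaussian : stdComplexGaussian.map Complex.re = gaussianReal 0 (1 / 2) := by
  have h := Measure.map_map (μ := (gaussianReal 0 (1 / 2)).prod (gaussianReal 0 (1 / 2)))
    Complex.measurable_re Complex.measurableEquivRealProd.symm.measurable
  exact h.trans measurePreserving_fst.map_eq

lemma map_im_stdComplexGaussian : stdComplexGaussian.map Complex.im = gaussianReal 0 (1 / 2) := by
  have h := Measure.map_map (μ := (gaussianReal 0 (1 / 2)).prod (gaussianReal 0 (1 / 2)))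
    Complex.measurable_im Complex.measurableEquivRealProd.symm.measurable
  exact h.trans measurePreserving_snd.map_eq

lemma memLp_of_map_eq_gaussianReal {f : ℂ → ℝ} (hf : Measurable f)
    (h : stdComplexGaussian.map f = gaussianReal 0 (1 / 2)) : MemLp f 2 stdComplexGaussian := by
  have := memLp_id_gaussianReal (μ := 0) (v := 1 / 2) 2
  rw [← h] at this
  exact (memLp_map_measure_iff aestronglyMeasurable_id hf.aemeasurable).1 this

lemma integral_of_map_eq_gaussianReal {f : ℂ → ℝ} (hf : Measurable f)
    (h : stdComplexGaussian.map f = gaussianReal 0 (1 / 2)) :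
    ∫ z, f z ∂stdComplexGaussian = 0 := by
  have := integral_map (μ := stdComplexGaussian) hf.aemeasurable
    (f := fun x : ℝ => x) aestronglyMeasurable_id
  rw [← this, h, integral_id_gaussianReal]

lemma integral_sq_of_map_eq_gaussianReal {f : ℂ → ℝ} (hf : Measurable f)
    (h : stdComplexGaussian.map f = gaussianReal 0 (1 / 2)) :
    ∫ z, f z ^ 2 ∂stdComplexGaussian = 1 / 2 := by
  have := integral_map (μ := stdComplexGaussian) hf.aemeasurable
    (f := fun x : ℝ => x ^ 2) (by fun_prop)
  rw [← this, h]
  have hv := variance_fun_id_gaussianReal (μ := 0) (v := 1 / 2)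
  rw [variance_of_integral_eq_zero (X := fun x : ℝ => x) aemeasurable_id (integral_id_gaussianReal)] at hv
  simpa using hv

lemma memLp_id_stdComplexGaussian : MemLp (fun z : ℂ => z) 2 stdComplexGaussian := by
  rw [← memLp_re_im_iff]
  exact ⟨memLp_of_map_eq_gaussianReal Complex.measurable_re map_re_stdComplexGaussian,
    memLp_of_map_eq_gaussianReal Complex.measurable_im map_im_stdComplexGaussian⟩

lemma integral_id_stdComplexGaussian : ∫ z, z ∂stdComplexGaussian = 0 := by
  have hi : Integrable (fun z : ℂ => z) stdComplexGaussian :=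
    memLp_id_stdComplexGaussian.integrable (by norm_num)
  rw [← integral_re_add_im hi]
  have h1 := integral_of_map_eq_gaussianReal Complex.measurable_re map_re_stdComplexGaussian
  have h2 := integral_of_map_eq_gaussianReal Complex.measurable_im map_im_stdComplexGaussian
  simp only [RCLike.re_to_complex, RCLike.im_to_complex]
  simp [h1, h2]

lemma integral_normSq_stdComplexGaussian :
    ∫ z, (starRingEnd ℂ z * z) ∂stdComplexGaussian = 1 := by
  have h1 := integral_sq_of_map_eq_gaussianReal Complex.measurable_re map_re_stdComplexGaussian
  have h2 := integral_sq_of_map_eq_gaussianReal Complex.measurable_im map_im_stdComplexGaussian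
  have m1 := (memLp_of_map_eq_gaussianReal Complex.measurable_re
    map_re_stdComplexGaussian).integrable_sq
  have m2 := (memLp_of_map_eq_gaussianReal Complex.measurable_im
    map_im_stdComplexGaussian).integrable_sq
  have h : ∀ z : ℂ, starRingEnd ℂ z * z = ((z.re ^ 2 + z.im ^ 2 : ℝ) : ℂ) := by
    intro z
    rw [← Complex.normSq_eq_conj_mul_self, Complex.normSq_apply]
    congr 1; ring
  simp_rw [h]
  rw [integral_complex_ofReal, integral_add m1 m2, h1, h2]
  norm_num

variable {ι : Type*} [Fintype ι]

lemma memLp_eval_pi_stdComplexGaussian (i : ι) :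
    MemLp (fun z : ι → ℂ => z i) 2 (Measure.pi fun _ : ι => stdComplexGaussian) :=
  memLp_id_stdComplexGaussian.comp_measurePreserving (measurePreserving_eval _ i)

lemma integrable_conj_mul_pi_stdComplexGaussian (i j : ι) :
    Integrable (fun z : ι → ℂ => starRingEnd ℂ (z i) * z j)
      (Measure.pi fun _ : ι => stdComplexGaussian) :=
  (memLp_eval_pi_stdComplexGaussian i).star.integrable_mul (memLp_eval_pi_stdComplexGaussian j)

lemma integral_eval_pi_stdComplexGaussian (i : ι) {f : ℂ → ℂ} (hf : Continuous f) :
    ∫ z : ι → ℂ, f (z i) ∂(Measure.pi fun _ : ι => stdComplexGaussian) =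
      ∫ z, f z ∂stdComplexGaussian := by
  have h := measurePreserving_eval (fun _ : ι => stdComplexGaussian) i
  have h2 := integral_map (μ := Measure.pi fun _ : ι => stdComplexGaussian) (φ := Function.eval i)
    h.measurable.aemeasurable (f := f) hf.aestronglyMeasurable
  rw [h.map_eq] at h2
  exact h2.symm

lemma integral_conj_mul_pi_stdComplexGaussian [DecidableEq ι] (i j : ι) :
    ∫ z : ι → ℂ, starRingEnd ℂ (z i) * z j ∂(Measure.pi fun _ : ι => stdComplexGaussian) =
      if i = j then 1 else 0 := by
  split_ifs with h
  · subst h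
    rw [← integral_normSq_stdComplexGaussian]
    exact integral_eval_pi_stdComplexGaussian i (f := fun z => starRingEnd ℂ z * z)
      (Complex.continuous_conj.mul continuous_id)
  · have hind : iIndepFun (fun i (z : ι → ℂ) => z i) (Measure.pi fun _ : ι => stdComplexGaussian) :=
      iIndepFun_pi (X := fun _ z => z) fun _ => aemeasurable_id
    have h2 : IndepFun (fun z : ι → ℂ => starRingEnd ℂ (z i)) (fun z => z j)
        (Measure.pi fun _ : ι => stdComplexGaussian) :=
      (hind.indepFun h).comp (φ := starRingEnd ℂ) (ψ := id) Complex.continuous_conj.measurable measurable_id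
    rw [h2.integral_fun_mul_eq_mul_integral (memLp_eval_pi_stdComplexGaussian i).star.1
      (memLp_eval_pi_stdComplexGaussian j).1]
    have : ∫ z : ι → ℂ, z j ∂(Measure.pi fun _ : ι => stdComplexGaussian) = 0 := by
      rw [← integral_id_stdComplexGaussian]
      exact integral_eval_pi_stdComplexGaussian j continuous_id
    rw [this, mul_zero]

lemma quadratic_form_eq_sum (G : Matrix ι ι ℂ) (z : ι → ℂ) :
    star z ⬝ᵥ (G *ᵥ z) = ∑ i, ∑ j, G i j * (starRingEnd ℂ (z i) * z j) := by
  simp only [dotProduct, mulVec, Finset.mul_sum, Pi.star_apply]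
  refine Finset.sum_congr rfl fun i _ => Finset.sum_congr rfl fun j _ => ?_
  change starRingEnd ℂ (z i) * _ = _
  ring

lemma integrable_quadratic_form_pi (G : Matrix ι ι ℂ) :
    Integrable (fun z : ι → ℂ => star z ⬝ᵥ (G *ᵥ z))
      (Measure.pi fun _ : ι => stdComplexGaussian) := by
  simp_rw [quadratic_form_eq_sum]
  exact integrable_finsetSum _ fun i _ => integrable_finsetSum _ fun j _ =>
    (integrable_conj_mul_pi_stdComplexGaussian i j).const_mul _

lemma integral_quadratic_form_pi (G : Matrix ι ι ℂ) :
    ∫ z : ι → ℂ, star z ⬝ᵥ (G *ᵥ z) ∂(Measure.pi fun _ : ι => stdComplexGaussian) = G.trace := by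
  classical
  simp_rw [quadratic_form_eq_sum]
  have hi : ∀ i j, Integrable (fun z : ι → ℂ => G i j * (starRingEnd ℂ (z i) * z j))
      (Measure.pi fun _ : ι => stdComplexGaussian) :=
    fun i j => (integrable_conj_mul_pi_stdComplexGaussian i j).const_mul _
  rw [integral_finsetSum _ fun i _ => integrable_finsetSum _ fun j _ => hi i j]
  refine Finset.sum_congr rfl fun i _ => ?_
  rw [integral_finsetSum _ fun j _ => hi i j]
  simp_rw [integral_const_mul, integral_conj_mul_pi_stdComplexGaussian]
  simp

lemma quadratic_form_mulVec {S : Matrix ι ι ℂ} (hS : S.IsHermitian) (D : Matrix ι ι ℂ)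
    (z : ι → ℂ) : star (S *ᵥ z) ⬝ᵥ (D *ᵥ (S *ᵥ z)) = star z ⬝ᵥ ((S * D * S) *ᵥ z) := by
  rw [star_mulVec, hS.eq, ← dotProduct_mulVec, mulVec_mulVec, mulVec_mulVec, Matrix.mul_assoc]

lemma continuous_quadratic_form (D : Matrix ι ι ℂ) :
    Continuous fun h : ι → ℂ => star h ⬝ᵥ (D *ᵥ h) :=
  Continuous.dotProduct continuous_star (Continuous.matrix_mulVec continuous_const continuous_id)

variable [DecidableEq ι]

lemma integrable_quadratic_form (A D : Matrix ι ι ℂ) :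
    Integrable (fun h : ι → ℂ => star h ⬝ᵥ (D *ᵥ h)) (complexGaussian A) := by
  rw [complexGaussian, integrable_map_measure (continuous_quadratic_form D).aestronglyMeasurable
    (measurable_mulVec _).aemeasurable]
  refine (integrable_quadratic_form_pi (CFC.sqrt A * D * CFC.sqrt A)).congr (.of_forall fun z => ?_)
  exact (quadratic_form_mulVec (isHermitian_cfcSqrt A) D z).symm

lemma integral_quadratic_form {A : Matrix ι ι ℂ} (hA : A.PosSemidef) (D : Matrix ι ι ℂ) :
    ∫ h, star h ⬝ᵥ (D *ᵥ h) ∂(complexGaussian A) = (A * D).trace := by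
  rw [complexGaussian, integral_map (measurable_mulVec _).aemeasurable
    (continuous_quadratic_form D).aestronglyMeasurable]
  simp_rw [quadratic_form_mulVec (isHermitian_cfcSqrt A), integral_quadratic_form_pi]
  rw [trace_mul_comm, ← Matrix.mul_assoc, CFC.sqrt_mul_sqrt_self A hA.nonneg]

lemma llr_eq {A₀ A₁ : Matrix ι ι ℂ} (h₀ : A₀.PosDef) (h₁ : A₁.PosDef) (h : ι → ℂ) :
    llr A₀ A₁ h = (star h ⬝ᵥ (A₀⁻¹ *ᵥ h)).re - (star h ⬝ᵥ (A₁⁻¹ *ᵥ h)).re +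
      (Real.log A₀.det.re - Real.log A₁.det.re) := by
  have p0 := det_re_pos h₀
  have p1 := det_re_pos h₁
  have key : ∀ {A : Matrix ι ι ℂ}, 0 < A.det.re → Real.log (gaussianDensity A h) =
      -(star h ⬝ᵥ (A⁻¹ *ᵥ h)).re - (Real.log (Real.pi ^ Fintype.card ι) + Real.log A.det.re) := by
    intro A hA
    rw [gaussianDensity, Real.log_div (by positivity) (by positivity), Real.log_exp,
      Real.log_mul (by positivity) (by positivity)]
  rw [llr, key p0, key p1]
  ring

lemma integrable_llr {A₀ A₁ : Matrix ι ι ℂ} (h₀ : A₀.PosDef) (h₁ : A₁.PosDef) (A : Matrix ι ι ℂ) :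
    Integrable (llr A₀ A₁) (complexGaussian A) := by
  rw [funext (llr_eq h₀ h₁)]
  exact ((integrable_quadratic_form A _).re.sub (integrable_quadratic_form A _).re).add
    (integrable_const _)

lemma det_im_eq_zero {A : Matrix ι ι ℂ} (hA : A.PosDef) : A.det.im = 0 :=
  (Complex.lt_def.1 hA.det_pos).2.symm

/-- Under covariance `A₁` the form of `A₀⁻¹` has mean `tr (A₁ A₀⁻¹)` and that of `A₁⁻¹` has mean `tr
1 = M`; the normalizing constants give the log-determinant. -/
lemma integral_llr {A₀ A₁ : Matrix ι ι ℂ} (h₀ : A₀.PosDef) (h₁ : A₁.PosDef) :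
    ∫ h, llr A₀ A₁ h ∂(complexGaussian A₁) = logDetDiv A₁ A₀ := by
  have p0 := det_re_pos h₀
  have p1 := det_re_pos h₁
  have i0 := integrable_quadratic_form A₁ A₀⁻¹
  have i1 := integrable_quadratic_form A₁ A₁⁻¹
  have hre : ∀ D : Matrix ι ι ℂ,
      ∫ h, (star h ⬝ᵥ (D *ᵥ h)).re ∂(complexGaussian A₁) = (A₁ * D).trace.re := by
    intro D
    rw [← integral_quadratic_form h₁.posSemidef]
    exact integral_re (integrable_quadratic_form A₁ D)
  have hdet : (A₁ * A₀⁻¹).det.re = A₁.det.re / A₀.det.re := by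
    have e0 : A₀.det = (A₀.det.re : ℂ) := by
      apply Complex.ext <;> simp [det_im_eq_zero h₀]
    have e1 : A₁.det = (A₁.det.re : ℂ) := by
      apply Complex.ext <;> simp [det_im_eq_zero h₁]
    rw [det_mul, det_nonsing_inv, Ring.inverse_eq_inv', e0, e1, ← Complex.ofReal_inv,
      ← Complex.ofReal_mul]
    simp only [Complex.ofReal_re, div_eq_mul_inv]
  have i2 : Integrable (fun h => (star h ⬝ᵥ (A₀⁻¹ *ᵥ h)).re) (complexGaussian A₁) := i0.re
  have i3 : Integrable (fun h => (star h ⬝ᵥ (A₁⁻¹ *ᵥ h)).re) (complexGaussian A₁) := i1.re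
  have i4 : Integrable (fun h => (star h ⬝ᵥ (A₀⁻¹ *ᵥ h)).re - (star h ⬝ᵥ (A₁⁻¹ *ᵥ h)).re)
    (complexGaussian A₁) := i2.sub i3
  simp_rw [llr_eq h₀ h₁]
  rw [integral_add i4 (integrable_const _), integral_sub i2 i3, hre, hre, logDetDiv, hdet, Real.log_div p1.ne' p0.ne',
    Matrix.mul_nonsing_inv _ (isUnit_iff_ne_zero.2 (by intro h; simp [h] at p1))]
  simp
  ring

/-- Whitening by `A₀^{-1/2}` turns the divergence into the sum of λ - 1 - log λ over the eigenvalues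
of `D = A₀^{-1/2} A₁ A₀^{-1/2}`. Every term is nonnegative and vanishes only at λ = 1; if all vanish
then `D = 1`, so `A₁ = A₀`. -/
lemma logDetDiv_pos {A₀ A₁ : Matrix ι ι ℂ} (h₀ : A₀.PosDef) (h₁ : A₁.PosDef) (hne : A₁ ≠ A₀) :
    0 < logDetDiv A₁ A₀ := by
  set S := CFC.sqrt A₀ with hSdef
  have hSu : IsUnit S.det := isUnit_det_cfcSqrt h₀
  have hSH : S.IsHermitian := isHermitian_cfcSqrt A₀
  have hSS : S * S = A₀ := CFC.sqrt_mul_sqrt_self A₀ h₀.posSemidef.nonneg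
  have hI : S⁻¹.IsHermitian := hSH.inv
  set D := S⁻¹ * A₁ * S⁻¹ with hDdef
  have hD : D.PosDef := by
    have := h₁.conjTranspose_mul_mul_same (B := S⁻¹) (by
      apply mulVec_injective_of_isUnit
      exact (isUnit_iff_isUnit_det _).2 (by simpa using hSu.ne_zero))
    rwa [hI.eq] at this
  have hA0 : A₀⁻¹ = S⁻¹ * S⁻¹ := by rw [← hSS, Matrix.mul_inv_rev]
  have htr : (A₁ * A₀⁻¹).trace = D.trace := by
    rw [hA0, ← Matrix.mul_assoc, trace_mul_comm, ← Matrix.mul_assoc]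
  have hdet : (A₁ * A₀⁻¹).det = D.det := by
    rw [hA0, hDdef, det_mul, det_mul, det_mul, det_mul]; ring
  have hpos := hD.eigenvalues_pos
  have hval : logDetDiv A₁ A₀ =
      ∑ i, (hD.isHermitian.eigenvalues i - 1 - Real.log (hD.isHermitian.eigenvalues i)) := by
    rw [logDetDiv, htr, hdet, hD.isHermitian.trace_eq_sum_eigenvalues,
      hD.isHermitian.det_eq_prod_eigenvalues]
    have e1 : (∏ i, ((hD.isHermitian.eigenvalues i : ℝ) : ℂ)).re =
        ∏ i, hD.isHermitian.eigenvalues i := by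
      rw [← Complex.ofReal_prod, Complex.ofReal_re]
    have e2 : (∑ i, ((hD.isHermitian.eigenvalues i : ℝ) : ℂ)).re =
        ∑ i, hD.isHermitian.eigenvalues i := by
      rw [← Complex.ofReal_sum, Complex.ofReal_re]
    simp only [Complex.coe_algebraMap] at *
    rw [e1, e2, Real.log_prod fun i _ => (hpos i).ne', Finset.sum_sub_distrib,
      Finset.sum_sub_distrib]
    simp
    ring
  rw [hval]
  have hnn : ∀ i, 0 ≤ hD.isHermitian.eigenvalues i - 1 - Real.log (hD.isHermitian.eigenvalues i) :=
    fun i => by have := Real.log_le_sub_one_of_pos (hpos i); linarith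
  refine Finset.sum_pos' (fun i _ => hnn i) ?_
  by_contra hcon
  push Not at hcon
  have hone : ∀ i, hD.isHermitian.eigenvalues i = 1 := by
    intro i
    by_contra h1
    have := Real.log_lt_sub_one_of_pos (hpos i) h1
    have := hcon i (Finset.mem_univ i)
    linarith
  apply hne
  have hD1 : D = 1 := by
    rw [hD.isHermitian.spectral_theorem]
    have : (RCLike.ofReal ∘ hD.isHermitian.eigenvalues : ι → ℂ) = 1 := by
      funext i; simp [hone i]
    rw [this]
    have h1 : (diagonal (1 : ι → ℂ)) = 1 := diagonal_one
    rw [h1, map_one]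
  have : S * D * S = A₁ := by
    rw [hDdef, Matrix.mul_assoc, Matrix.mul_assoc, Matrix.nonsing_inv_mul _ hSu, Matrix.mul_one,
      ← Matrix.mul_assoc, Matrix.mul_nonsing_inv _ hSu, Matrix.one_mul]
  rw [← this, hD1, Matrix.mul_one, hSS]

end Moments

/-! ### Bounds on the mean alarm time of CUSUM for independent increments. -/

section Sequential

/-- No sum of consecutive terms of `x` among the first `n` exceeds `θ`. -/
def Quiet (θ : ℝ) (x : ℕ → ℝ) (n : ℕ) : Prop :=
  ∀ j ≤ n, ∀ p < j, ∑ i ∈ Finset.Ico p j, x i ≤ θ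

lemma Quiet.mono {θ : ℝ} {x : ℕ → ℝ} {m n : ℕ} (h : Quiet θ x n) (hmn : m ≤ n) : Quiet θ x m :=
  fun j hj => h j (hj.trans hmn)

lemma Quiet.mono_threshold {θ θ' : ℝ} {x : ℕ → ℝ} {n : ℕ} (h : Quiet θ x n) (hθ : θ ≤ θ') :
    Quiet θ' x n :=
  fun j hj p hp => (h j hj p hp).trans hθ

lemma Quiet.shift {θ : ℝ} {x : ℕ → ℝ} {m n : ℕ} (h : Quiet θ x (m + n)) :
    Quiet θ (fun i => x (m + i)) n := by
  intro j hj p hp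
  have := h (m + j) (by omega) (m + p) (by omega)
  rwa [add_comm m p, add_comm m j, ← Finset.sum_Ico_add x p j m] at this

lemma quiet_zero (θ : ℝ) (x : ℕ → ℝ) : Quiet θ x 0 := by
  intro j hj p hp
  omega

/-- The σ-algebra is a variable so that the past, the future and the σ-algebra of the first `n`
terms can all be substituted for it. -/
lemma measurableSet_quiet {Ω : Type*} {mΩ : MeasurableSpace Ω} {x : ℕ → Ω → ℝ} {n : ℕ}
    (hx : ∀ i < n, Measurable (x i)) (θ : ℝ) :
    MeasurableSet {ω | Quiet θ (fun i => x i ω) n} := by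
  have : {ω | Quiet θ (fun i => x i ω) n} =
      ⋂ j : ℕ, ⋂ _ : j ≤ n, ⋂ p : ℕ, ⋂ _ : p < j, {ω | ∑ i ∈ Finset.Ico p j, x i ω ≤ θ} := by
    ext ω
    simp [Quiet]
  rw [this]
  refine .iInter fun j => .iInter fun hj => .iInter fun p => .iInter fun _ => ?_
  refine measurableSet_le (Finset.measurable_fun_sum _ fun i hi => hx i ?_) measurable_const
  have := Finset.mem_Ico.1 hi
  omega

lemma measurableSet_sum_le {Ω : Type*} {mΩ : MeasurableSpace Ω} {x : ℕ → Ω → ℝ} {s : Finset ℕ}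
    (hx : ∀ i ∈ s, Measurable (x i)) (θ : ℝ) : MeasurableSet {ω | ∑ i ∈ s, x i ω ≤ θ} :=
  measurableSet_le (Finset.measurable_fun_sum _ hx) measurable_const

variable {Ω : Type*} [MeasurableSpace Ω]

/-- A sequence of independent random variables with common law `μ`. -/
structure IsIID (x : ℕ → Ω → ℝ) (μ : Measure ℝ) (Q : Measure Ω) : Prop where
  measurable : ∀ i, Measurable (x i)
  indep : iIndepFun x Q
  map_eq : ∀ i, Q.map (x i) = μ

lemma IsIID.shift {x : ℕ → Ω → ℝ} {μ : Measure ℝ} {Q : Measure Ω} (h : IsIID x μ Q) (m : ℕ) :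
    IsIID (fun i => x (m + i)) μ Q :=
  ⟨fun _ => h.measurable _, h.indep.precomp (add_right_injective m), fun _ => h.map_eq _⟩

lemma IsIID.measure_eq {Ω' : Type*} [MeasurableSpace Ω'] {x : ℕ → Ω → ℝ} {y : ℕ → Ω' → ℝ}
    {μ : Measure ℝ} {Q : Measure Ω} {Q' : Measure Ω'} (h : IsIID x μ Q) (h' : IsIID y μ Q')
    {B : Set (ℕ → ℝ)} (hB : MeasurableSet B) :
    Q {ω | (fun i => x i ω) ∈ B} = Q' {ω | (fun i => y i ω) ∈ B} := by
  have e := h.indep.map_fun_eq_infinitePi_map h.measurable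
  have e' := h'.indep.map_fun_eq_infinitePi_map h'.measurable
  rw [funext h.map_eq] at e
  rw [funext h'.map_eq] at e'
  have hm : Measurable fun ω i => x i ω := measurable_pi_iff.2 h.measurable
  have hm' : Measurable fun ω i => y i ω := measurable_pi_iff.2 h'.measurable
  change Q ((fun ω i => x i ω) ⁻¹' B) = Q' ((fun ω i => y i ω) ⁻¹' B)
  rw [← Measure.map_apply hm hB, ← Measure.map_apply hm' hB, e, e']

lemma IsIID.measure_quiet_eq {Ω' : Type*} [MeasurableSpace Ω'] {x : ℕ → Ω → ℝ} {y : ℕ → Ω' → ℝ}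
    {μ : Measure ℝ} {Q : Measure Ω} {Q' : Measure Ω'} (h : IsIID x μ Q) (h' : IsIID y μ Q')
    (θ : ℝ) (n : ℕ) :
    Q {ω | Quiet θ (fun i => x i ω) n} = Q' {ω | Quiet θ (fun i => y i ω) n} :=
  h.measure_eq h' (B := {v | Quiet θ v n})
    (measurableSet_quiet (x := fun i (v : ℕ → ℝ) => v i) (fun i _ => measurable_pi_apply i) θ)

/-- The σ-algebra generated by the terms of `x` with index in `S`. -/
abbrev sigmaOf {Ω : Type*} (x : ℕ → Ω → ℝ) (S : Set ℕ) : MeasurableSpace Ω :=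
  ⨆ i ∈ S, MeasurableSpace.comap (x i) inferInstance

lemma measurable_sigmaOf {Ω : Type*} (x : ℕ → Ω → ℝ) {S : Set ℕ} {i : ℕ} (hi : i ∈ S) :
    Measurable[sigmaOf x S] (x i) :=
  measurable_iff_comap_le.2 (le_iSup₂ (f := fun i (_ : i ∈ S) =>
    MeasurableSpace.comap (x i) inferInstance) i hi)

lemma sigmaOf_le {x : ℕ → Ω → ℝ} (hx : ∀ i, Measurable (x i)) (S : Set ℕ) :
    sigmaOf x S ≤ ‹MeasurableSpace Ω› :=
  iSup₂_le fun i _ => (hx i).comap_le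

lemma indep_past_future {x : ℕ → Ω → ℝ} {Q : Measure Ω} (hx : ∀ i, Measurable (x i))
    (hQ : iIndepFun x Q) (m : ℕ) : Indep (sigmaOf x (Set.Iio m)) (sigmaOf x (Set.Ici m)) Q :=
  indep_iSup_of_disjoint (fun i => (hx i).comap_le) hQ
    (Set.disjoint_left.2 fun _ h h' => not_lt.2 (Set.mem_Ici.1 h') (Set.mem_Iio.1 h))

lemma measurableSet_quiet_past {Ω : Type*} (x : ℕ → Ω → ℝ) (θ : ℝ) (m : ℕ) :
    MeasurableSet[sigmaOf x (Set.Iio m)] {ω | Quiet θ (fun i => x i ω) m} :=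
  @measurableSet_quiet Ω (sigmaOf x (Set.Iio m)) x m
    (fun _ hi => measurable_sigmaOf x (Set.mem_Iio.2 hi)) θ

lemma measure_quiet_inter_shift {x : ℕ → Ω → ℝ} {Q : Measure Ω} (hx : ∀ i, Measurable (x i))
    (hQ : iIndepFun x Q) (θ : ℝ) (m n : ℕ) :
    Q ({ω | Quiet θ (fun i => x i ω) m} ∩ {ω | Quiet θ (fun i => x (m + i) ω) n}) =
      Q {ω | Quiet θ (fun i => x i ω) m} * Q {ω | Quiet θ (fun i => x (m + i) ω) n} :=
  (Indep_iff _ _ _).1 (indep_past_future hx hQ m) _ _ (measurableSet_quiet_past x θ m)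
    (@measurableSet_quiet Ω (sigmaOf x (Set.Ici m)) (fun i => x (m + i)) n
      (fun i _ => measurable_sigmaOf x (Set.mem_Ici.2 (Nat.le_add_right m i))) θ)

/-- Cutting ℕ into blocks of length `n` bounds the sum by `n` times a geometric series of ratio `1 -
r`. -/
lemma tsum_le_mul_inv_of_le_mul {s : ℕ → ℝ≥0∞} (hs : Antitone s) (hs0 : s 0 ≤ 1) {n : ℕ}
    (hn : n ≠ 0) {r : ℝ≥0∞} (hr : r ≤ 1) (h : ∀ m, s (m + n) ≤ s m * (1 - r)) :
    ∑' j, s j ≤ n * r⁻¹ := by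
  have hpow : ∀ k, s (k * n) ≤ (1 - r) ^ k := by
    intro k
    induction k with
    | zero => simpa using hs0
    | succ k ih =>
      rw [Nat.succ_mul, pow_succ]
      exact (h _).trans (mul_le_mul_left ih _)
  have : NeZero n := ⟨hn⟩
  rw [← (Nat.divModEquiv n).symm.tsum_eq, ENNReal.tsum_prod']
  calc ∑' (k : ℕ) (i : Fin n), s ((Nat.divModEquiv n).symm (k, i))
      ≤ ∑' (k : ℕ) (_ : Fin n), (1 - r) ^ k := by
        refine ENNReal.tsum_le_tsum fun k => ENNReal.tsum_le_tsum fun i => ?_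
        refine (hs ?_).trans (hpow k)
        simp [Nat.divModEquiv]
    _ = n * r⁻¹ := by
        simp_rw [tsum_fintype, Finset.sum_const, Finset.card_univ, Fintype.card_fin, nsmul_eq_mul]
        rw [ENNReal.tsum_mul_left, ENNReal.tsum_geometric, ENNReal.sub_sub_cancel (by simp) hr]

lemma antitone_measure_quiet (x : ℕ → Ω → ℝ) (Q : Measure Ω) (θ : ℝ) :
    Antitone fun n => Q {ω | Quiet θ (fun i => x i ω) n} :=
  fun _ _ hmn => measure_mono fun _ h => Quiet.mono h hmn

/-- The expected alarm time is at most `n / P(x₀ + ⋯ + xₙ₋₁ > θ)`. -/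
lemma IsIID.tsum_measure_quiet_le {x : ℕ → Ω → ℝ} {μ : Measure ℝ} {Q : Measure Ω}
    [IsProbabilityMeasure Q] (h : IsIID x μ Q) (θ : ℝ) {n : ℕ} (hn : n ≠ 0) :
    ∑' j, Q {ω | Quiet θ (fun i => x i ω) j} ≤
      n * (Q {ω | θ < ∑ i ∈ Finset.range n, x i ω})⁻¹ := by
  refine tsum_le_mul_inv_of_le_mul (antitone_measure_quiet x Q θ) prob_le_one hn prob_le_one
    fun m => ?_
  have hB : MeasurableSet {v : ℕ → ℝ | θ < ∑ i ∈ Finset.range n, v i} :=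
    measurableSet_lt measurable_const
      (Finset.measurable_fun_sum _ fun i _ => measurable_pi_apply i)
  have hm : Measurable fun ω => ∑ i ∈ Finset.range n, x (m + i) ω :=
    Finset.measurable_fun_sum _ fun i _ => h.measurable _
  have e := h.measure_eq (h.shift m) hB
  simp only [Set.mem_ofPred_eq] at e
  have hc : {ω | θ < ∑ i ∈ Finset.range n, x (m + i) ω}ᶜ =
      {ω | ∑ i ∈ Finset.range n, x (m + i) ω ≤ θ} := by
    ext ω; simp
  rw [e, ← prob_compl_eq_one_sub (measurableSet_lt measurable_const hm), hc]
  have hind := (Indep_iff _ _ _).1 (indep_past_future h.measurable h.indep m) _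
    {ω | ∑ i ∈ Finset.range n, x (m + i) ω ≤ θ} (measurableSet_quiet_past x θ m)
    (@measurableSet_sum_le Ω (sigmaOf x (Set.Ici m)) (fun i => x (m + i)) (Finset.range n)
      (fun i _ => measurable_sigmaOf x (Set.mem_Ici.2 (Nat.le_add_right m i))) θ)
  rw [← hind]
  -- Being quiet up to `m + n` entails being quiet up to `m` and having the next `n` terms sum to at
  -- most θ, two independent events.
  refine measure_mono fun ω hω => ⟨Quiet.mono hω (Nat.le_add_right m n), ?_⟩
  have := (Quiet.shift hω) n le_rfl 0 (Nat.pos_of_ne_zero hn)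
  rwa [← Finset.range_eq_Ico] at this

/-- The Shiryaev–Roberts statistic. -/
noncomputable def shiryaevRoberts (x : ℕ → ℝ) (n : ℕ) : ℝ≥0∞ :=
  ∑ p ∈ Finset.range n, ENNReal.ofReal (Real.exp (∑ i ∈ Finset.Ico p n, x i))

/-- When `e^{x n}` has mean one and is independent of the past, this recursion makes the statistic
minus `n` a martingale. -/
lemma shiryaevRoberts_succ (x : ℕ → ℝ) (n : ℕ) :
    shiryaevRoberts x (n + 1) =
      (shiryaevRoberts x n + 1) * ENNReal.ofReal (Real.exp (x n)) := by
  have key : ∀ p ∈ Finset.range n,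
      ENNReal.ofReal (Real.exp (∑ i ∈ Finset.Ico p (n + 1), x i)) =
      ENNReal.ofReal (Real.exp (∑ i ∈ Finset.Ico p n, x i)) * ENNReal.ofReal (Real.exp (x n)) := by
    intro p hp
    rw [Finset.sum_Ico_succ_top (Finset.mem_range.1 hp).le, Real.exp_add,
      ENNReal.ofReal_mul (Real.exp_pos _).le]
  rw [shiryaevRoberts, Finset.sum_range_succ, Finset.sum_congr rfl key, ← Finset.sum_mul]
  simp [shiryaevRoberts, add_mul]

lemma measurable_shiryaevRoberts {Ω : Type*} {mΩ : MeasurableSpace Ω} {x : ℕ → Ω → ℝ} {n : ℕ}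
    (hx : ∀ i < n, Measurable (x i)) :
    Measurable fun ω => shiryaevRoberts (fun i => x i ω) n := by
  unfold shiryaevRoberts
  refine Finset.measurable_fun_sum _ fun p _ => ?_
  refine (Finset.measurable_fun_sum _ fun i hi => hx i ?_).exp.ennreal_ofReal
  exact (Finset.mem_Ico.1 hi).2

lemma measurable_indicator_shiryaevRoberts {Ω : Type*} {mΩ : MeasurableSpace Ω} {x : ℕ → Ω → ℝ}
    {n : ℕ} (hx : ∀ i < n, Measurable (x i)) (θ : ℝ) :
    Measurable ({ω | Quiet θ (fun i => x i ω) n}.indicator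
      fun ω => shiryaevRoberts (fun i => x i ω) n + 1) :=
  ((measurable_shiryaevRoberts hx).add_const 1).indicator (measurableSet_quiet hx θ)

/-- The window responsible for the alarm must end at `n + 1`, so its exponential is one of the
nonnegative summands of the statistic. -/
lemma le_shiryaevRoberts {θ : ℝ} {x : ℕ → ℝ} {n : ℕ} (h : Quiet θ x n) (h' : ¬ Quiet θ x (n + 1)) :
    ENNReal.ofReal (Real.exp θ) ≤ shiryaevRoberts x (n + 1) := by
  simp only [Quiet, not_forall] at h'
  obtain ⟨j, hj, p, hp, hlt⟩ := h'
  have hjn : j = n + 1 := by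
    by_contra hne
    exact hlt (h j (by omega) p hp)
  subst hjn
  refine le_trans ?_ (Finset.single_le_sum (f := fun p =>
    ENNReal.ofReal (Real.exp (∑ i ∈ Finset.Ico p (n + 1), x i))) (fun _ _ => zero_le)
    (Finset.mem_range.2 hp))
  exact ENNReal.ofReal_le_ofReal (Real.exp_le_exp.2 (not_le.1 hlt).le)

/-- Lorden's inequality before time `m`, for increments whose exponential has mean one. -/
lemma IsIID.exp_mul_measure_add_lintegral_le {x : ℕ → Ω → ℝ} {μ : Measure ℝ} {Q : Measure Ω}
    [IsProbabilityMeasure Q] (h : IsIID x μ Q)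
    (hμ : ∫⁻ y, ENNReal.ofReal (Real.exp y) ∂μ = 1) (θ : ℝ) (m : ℕ) :
    ENNReal.ofReal (Real.exp θ) * Q {ω | Quiet θ (fun i => x i ω) m}ᶜ +
        ∫⁻ ω in {ω | Quiet θ (fun i => x i ω) m}, shiryaevRoberts (fun i => x i ω) m ∂Q ≤
      ∑ n ∈ Finset.range m, Q {ω | Quiet θ (fun i => x i ω) n} := by
  -- Optional stopping of the martingale R_n - n at min(τ, m), carried out one step at a time; the
  -- right-hand side is E min(τ, m).
  induction m with
  | zero =>
    have : {ω | Quiet θ (fun i => x i ω) 0} = Set.univ := by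
      ext ω; simp [quiet_zero]
    simp [this, shiryaevRoberts]
  | succ m ih =>
    set A := {ω | Quiet θ (fun i => x i ω) m} with hA
    set A' := {ω | Quiet θ (fun i => x i ω) (m + 1)} with hA'
    have mA : MeasurableSet A := measurableSet_quiet (fun i _ => h.measurable i) θ
    have mA' : MeasurableSet A' := measurableSet_quiet (fun i _ => h.measurable i) θ
    have hsub : A' ⊆ A := fun ω hω => Quiet.mono hω (Nat.le_succ m)
    -- Martingale step: `A` and R_m depend only on the first `m` terms, while `e^{x m}` is
    -- independent of them and has mean one.
    have hint : ∫⁻ ω in A, shiryaevRoberts (fun i => x i ω) (m + 1) ∂Q =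
        ∫⁻ ω in A, shiryaevRoberts (fun i => x i ω) m ∂Q + Q A := by
      have hf : Measurable[sigmaOf x (Set.Iio m)]
          (A.indicator fun ω => shiryaevRoberts (fun i => x i ω) m + 1) :=
        @measurable_indicator_shiryaevRoberts Ω (sigmaOf x (Set.Iio m)) x m
          (fun i hi => measurable_sigmaOf x (Set.mem_Iio.2 hi)) θ
      have hg : Measurable[sigmaOf x (Set.Ici m)] fun ω => ENNReal.ofReal (Real.exp (x m ω)) :=
        (Real.measurable_exp.ennreal_ofReal).comp
          (measurable_sigmaOf x (Set.mem_Ici.2 le_rfl))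
      have hmul := lintegral_mul_eq_lintegral_mul_lintegral_of_independent_measurableSpace
        (sigmaOf_le h.measurable _) (sigmaOf_le h.measurable _)
        (indep_past_future h.measurable h.indep m) hf hg
      have hone : ∫⁻ ω, ENNReal.ofReal (Real.exp (x m ω)) ∂Q = 1 := by
        rw [← hμ, ← h.map_eq m, lintegral_map (by fun_prop) (h.measurable m)]
      rw [hone, mul_one, lintegral_indicator mA, lintegral_add_right _ measurable_const,
        setLIntegral_one] at hmul
      rw [← hmul, ← lintegral_indicator mA]
      refine lintegral_congr fun ω => ?_
      by_cases hω : ω ∈ A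
      · simp only [Set.indicator_of_mem hω, shiryaevRoberts_succ]
      · simp only [Set.indicator_of_notMem hω, zero_mul]
    -- On `A \ A'` the alarm is raised exactly at `m + 1`, where the statistic is at least `e^θ`.
    have hsplit : ∫⁻ ω in A', shiryaevRoberts (fun i => x i ω) (m + 1) ∂Q +
        ENNReal.ofReal (Real.exp θ) * Q (A \ A') ≤
        ∫⁻ ω in A, shiryaevRoberts (fun i => x i ω) (m + 1) ∂Q := by
      rw [← lintegral_inter_add_sdiff _ A mA', Set.inter_eq_self_of_subset_right hsub]
      gcongr
      rw [← setLIntegral_const]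
      exact setLIntegral_mono' (mA.diff mA') fun ω hω => le_shiryaevRoberts hω.1 hω.2
    have hcompl : Q A'ᶜ = Q Aᶜ + Q (A \ A') := by
      rw [← measure_union _ (mA.diff mA')]
      · congr 1
        ext ω
        by_cases h1 : ω ∈ A <;> by_cases h2 : ω ∈ A' <;> simp [h1, h2]
        exact h1 (hsub h2)
      · exact Set.disjoint_left.2 fun ω h1 h2 => h1 h2.1
    rw [Finset.sum_range_succ, hcompl, mul_add]
    calc _ = ENNReal.ofReal (Real.exp θ) * Q Aᶜ +
        (∫⁻ ω in A', shiryaevRoberts (fun i => x i ω) (m + 1) ∂Q +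
        ENNReal.ofReal (Real.exp θ) * Q (A \ A')) := by ring
      _ ≤ ENNReal.ofReal (Real.exp θ) * Q Aᶜ +
        (∫⁻ ω in A, shiryaevRoberts (fun i => x i ω) m ∂Q + Q A) := by
          rw [← hint]; gcongr
      _ ≤ _ := by rw [← add_assoc]; gcongr

lemma IsIID.exp_mul_measure_compl_quiet_le {x : ℕ → Ω → ℝ} {μ : Measure ℝ} {Q : Measure Ω}
    [IsProbabilityMeasure Q] (h : IsIID x μ Q)
    (hμ : ∫⁻ y, ENNReal.ofReal (Real.exp y) ∂μ = 1) (θ : ℝ) (m : ℕ) :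
    ENNReal.ofReal (Real.exp θ) * Q {ω | Quiet θ (fun i => x i ω) m}ᶜ ≤
      ∑ n ∈ Finset.range m, Q {ω | Quiet θ (fun i => x i ω) n} :=
  le_self_add.trans (h.exp_mul_measure_add_lintegral_le hμ θ m)

/-- Lorden's lower bound for the expected time to a false alarm. -/
lemma IsIID.exp_le_tsum_measure_quiet {x : ℕ → Ω → ℝ} {μ : Measure ℝ} {Q : Measure Ω}
    [IsProbabilityMeasure Q] (h : IsIID x μ Q)
    (hμ : ∫⁻ y, ENNReal.ofReal (Real.exp y) ∂μ = 1) (θ : ℝ) :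
    ENNReal.ofReal (Real.exp θ) ≤ ∑' n, Q {ω | Quiet θ (fun i => x i ω) n} := by
  -- If the mean alarm time is finite, its tail probabilities tend to 0, so the alarm probability in
  -- the truncated inequality tends to 1.
  by_cases htop : ∑' n, Q {ω | Quiet θ (fun i => x i ω) n} = ⊤
  · rw [htop]; exact le_top
  have h0 := ENNReal.tendsto_atTop_zero_of_tsum_ne_top htop
  have hlim : Tendsto (fun m => ENNReal.ofReal (Real.exp θ) *
      (1 - Q {ω | Quiet θ (fun i => x i ω) m})) atTop (𝓝 (ENNReal.ofReal (Real.exp θ) * (1 - 0))) :=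
    ENNReal.Tendsto.const_mul (ENNReal.Tendsto.sub tendsto_const_nhds h0 (by simp))
      (Or.inr ENNReal.ofReal_ne_top)
  rw [tsub_zero, mul_one] at hlim
  refine le_of_tendsto' hlim fun m => ?_
  rw [← prob_compl_eq_one_sub (measurableSet_quiet (fun i _ => h.measurable i) θ)]
  exact (h.exp_mul_measure_compl_quiet_le hμ θ m).trans (ENNReal.sum_le_tsum _)

end Sequential

/-! ### Change of measure on finitely many samples, and the law of large numbers. -/

section ChangeOfMeasure

variable {Ω : Type*} [MeasurableSpace Ω]

lemma IsIID.isProbabilityMeasure {x : ℕ → Ω → ℝ} {μ : Measure ℝ} {Q : Measure Ω}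
    (h : IsIID x μ Q) : IsProbabilityMeasure μ := by
  have := h.indep.isProbabilityMeasure
  rw [← h.map_eq 0]
  exact Measure.isProbabilityMeasure_map (h.measurable 0).aemeasurable

/-- Change of measure on an event determined by the first `n` terms. -/
lemma measure_eq_setLIntegral_exp_sum {x : ℕ → Ω → ℝ} {μ₀ μ₁ : Measure ℝ} {P₀ P₁ : Measure Ω}
    (h₀ : IsIID x μ₀ P₀) (h₁ : IsIID x μ₁ P₁)
    (hμ : μ₁ = μ₀.withDensity fun y => ENNReal.ofReal (Real.exp y)) {n : ℕ} {A : Set Ω}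
    (hA : MeasurableSet[MeasurableSpace.comap (fun ω (i : Fin n) => x i ω) inferInstance] A) :
    P₁ A = ∫⁻ ω in A, ENNReal.ofReal (Real.exp (∑ i ∈ Finset.range n, x i ω)) ∂P₀ := by
  -- The event is a preimage under the first `n` terms, so only two product measures on ℝⁿ have to
  -- be compared.
  obtain ⟨B, hB, rfl⟩ := hA
  have hp0 := h₀.isProbabilityMeasure
  have hp1 := h₁.isProbabilityMeasure
  have hQ0 := h₀.indep.isProbabilityMeasure
  have hQ1 := h₁.indep.isProbabilityMeasure
  have hm : Measurable fun ω (i : Fin n) => x i ω := measurable_pi_iff.2 fun i => h₀.measurable i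
  have i0 : iIndepFun (fun i : Fin n => x i) P₀ := h₀.indep.precomp Fin.val_injective
  have e0 := iIndepFun.map_fun_eq_pi_map (f := fun i : Fin n => x i)
    (fun i => (h₀.measurable i).aemeasurable) i0
  have i1 : iIndepFun (fun i : Fin n => x i) P₁ := h₁.indep.precomp Fin.val_injective
  have e1 := iIndepFun.map_fun_eq_pi_map (f := fun i : Fin n => x i)
    (fun i => (h₁.measurable i).aemeasurable) i1
  simp only [h₀.map_eq] at e0
  simp only [h₁.map_eq] at e1
  have he : Measurable fun y : ℝ => ENNReal.ofReal (Real.exp y) := by fun_prop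
  have hs : SigmaFinite (μ₀.withDensity fun y => ENNReal.ofReal (Real.exp y)) := by
    rw [← hμ]; infer_instance
  have hpi : Measure.pi (fun _ : Fin n => μ₁) = (Measure.pi fun _ : Fin n => μ₀).withDensity
      fun v => ∏ i, ENNReal.ofReal (Real.exp (v i)) := by
    rw [← pi_withDensity (fun _ : Fin n => μ₀) (fun _ => he), hμ]
  rw [← Measure.map_apply hm hB, e1, hpi, withDensity_apply _ hB, ← e0,
    setLIntegral_map hB (by fun_prop) hm]
  refine lintegral_congr fun ω => ?_
  rw [← ENNReal.ofReal_prod_of_nonneg fun i _ => (Real.exp_pos _).le, ← Real.exp_sum,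
    Fin.sum_univ_eq_sum_range (fun i => x i ω)]

lemma measurable_comap_fin {Ω : Type*} (x : ℕ → Ω → ℝ) {n i : ℕ} (hi : i < n) :
    Measurable[MeasurableSpace.comap (fun ω (i : Fin n) => x i ω) inferInstance] (x i) :=
  (measurable_pi_apply (⟨i, hi⟩ : Fin n)).comp
    (comap_measurable (fun ω (i : Fin n) => x i ω))

/-- Where the sum is at most `c`, the likelihood ratio of the first `n` terms is at most `e^c`. This
one inequality serves both transfers: a lower bound under `P₀` and an upper bound under `P₁`. -/
lemma measure_inter_le_exp_mul {x : ℕ → Ω → ℝ} {μ₀ μ₁ : Measure ℝ} {P₀ P₁ : Measure Ω}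
    (h₀ : IsIID x μ₀ P₀) (h₁ : IsIID x μ₁ P₁)
    (hμ : μ₁ = μ₀.withDensity fun y => ENNReal.ofReal (Real.exp y)) {n : ℕ} {A : Set Ω}
    (hA : MeasurableSet[MeasurableSpace.comap (fun ω (i : Fin n) => x i ω) inferInstance] A)
    (c : ℝ) :
    P₁ (A ∩ {ω | ∑ i ∈ Finset.range n, x i ω ≤ c}) ≤ ENNReal.ofReal (Real.exp c) * P₀ A := by
  have hS : MeasurableSet[MeasurableSpace.comap (fun ω (i : Fin n) => x i ω) inferInstance]
      {ω | ∑ i ∈ Finset.range n, x i ω ≤ c} :=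
    @measurableSet_sum_le Ω (MeasurableSpace.comap (fun ω (i : Fin n) => x i ω) inferInstance) x
      (Finset.range n) (fun i hi => measurable_comap_fin x (Finset.mem_range.1 hi)) c
  have hAS := @MeasurableSet.inter Ω
    (MeasurableSpace.comap (fun ω (i : Fin n) => x i ω) inferInstance) _ _ hA hS
  have hm : Measurable fun ω (i : Fin n) => x i ω := measurable_pi_iff.2 fun i => h₀.measurable i
  rw [measure_eq_setLIntegral_exp_sum h₀ h₁ hμ hAS]
  calc _ ≤ ∫⁻ _ in A ∩ {ω | ∑ i ∈ Finset.range n, x i ω ≤ c}, ENNReal.ofReal (Real.exp c) ∂P₀ :=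
        setLIntegral_mono' (hm.comap_le _ hAS) fun ω hω =>
          ENNReal.ofReal_le_ofReal (Real.exp_le_exp.2 hω.2)
    _ ≤ _ := by
        rw [setLIntegral_const]
        gcongr
        exact Set.inter_subset_left

lemma IsIID.tendsto_measure_mean_near {x : ℕ → Ω → ℝ} {μ : Measure ℝ} {Q : Measure Ω}
    (h : IsIID x μ Q) (hi : Integrable id μ) {ε : ℝ} (hε : 0 < ε) :
    Tendsto (fun n : ℕ => Q {ω | |(∑ i ∈ Finset.range n, x i ω) / n - ∫ y, y ∂μ| < ε})
      atTop (𝓝 1) := by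
  have hQ := h.indep.isProbabilityMeasure
  have hint : Integrable (x 0) Q := by
    rw [← h.map_eq 0, integrable_map_measure aestronglyMeasurable_id
      (h.measurable 0).aemeasurable] at hi
    exact hi
  have hmean : ∫ ω, x 0 ω ∂Q = ∫ y, y ∂μ := by
    rw [← h.map_eq 0, integral_map (f := fun y : ℝ => y) (h.measurable 0).aemeasurable
      aestronglyMeasurable_id]
  have hslln := strong_law_ae_real x hint (fun i j hij => h.indep.indepFun hij) fun i =>
    ⟨(h.measurable i).aemeasurable, (h.measurable 0).aemeasurable, by rw [h.map_eq, h.map_eq]⟩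
  have hmeas : ∀ n : ℕ, Measurable fun ω => (∑ i ∈ Finset.range n, x i ω) / (n : ℝ) := fun n =>
    (Finset.measurable_fun_sum _ fun i _ => h.measurable i).div_const _
  have hconv := tendstoInMeasure_of_tendsto_ae (fun n => (hmeas n).aestronglyMeasurable)
    (g := fun _ => ∫ ω, x 0 ω ∂Q) hslln
  rw [tendstoInMeasure_iff_dist] at hconv
  have h0 := hconv ε hε
  have h1 := ENNReal.Tendsto.sub (tendsto_const_nhds (x := (1 : ℝ≥0∞))) h0 (by simp)
  rw [tsub_zero] at h1
  refine h1.congr fun n => ?_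
  rw [← prob_compl_eq_one_sub
    (measurableSet_le measurable_const ((hmeas n).dist measurable_const))]
  congr 1
  ext ω
  simp [Real.dist_eq, hmean]

lemma tendsto_natCeil_mul_div {a : ℝ} (ha : 0 ≤ a) :
    Tendsto (fun θ : ℝ => (⌈a * θ⌉₊ : ℝ) / θ) atTop (𝓝 a) :=
  tendsto_nat_ceil_mul_div_atTop ha

lemma tendsto_natCeil_mul {a : ℝ} (ha : 0 < a) :
    Tendsto (fun θ : ℝ => ⌈a * θ⌉₊) atTop atTop :=
  tendsto_nat_ceil_atTop.comp (tendsto_id.const_mul_atTop ha)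

lemma IsIID.tendsto_measure_sum_mem_Ioc {x : ℕ → Ω → ℝ} {μ : Measure ℝ} {Q : Measure Ω}
    (h : IsIID x μ Q) (hi : Integrable id μ) {a b c : ℝ} (ha : 0 < a) (hb : b < a * ∫ y, y ∂μ)
    (hc : a * ∫ y, y ∂μ < c) :
    Tendsto (fun θ : ℝ => Q {ω | b * θ < ∑ i ∈ Finset.range ⌈a * θ⌉₊, x i ω ∧
      ∑ i ∈ Finset.range ⌈a * θ⌉₊, x i ω ≤ c * θ}) atTop (𝓝 1) := by
  have hQ := h.indep.isProbabilityMeasure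
  -- The sum divided by θ is (n/θ) · (S_n/n); continuity of the product at (mean, a) absorbs the
  -- rounding of n = ⌈aθ⌉ and the random error together.
  have hnhds : ∀ᶠ p : ℝ × ℝ in 𝓝 (∫ y, y ∂μ, a), b < p.2 * p.1 ∧ p.2 * p.1 < c := by
    have hcont : ContinuousAt (fun p : ℝ × ℝ => p.2 * p.1) (∫ y, y ∂μ, a) := by fun_prop
    exact (hcont.eventually (lt_mem_nhds hb)).and (hcont.eventually (gt_mem_nhds hc))
  rw [nhds_prod_eq, eventually_prod_iff] at hnhds
  obtain ⟨p, hp, q, hq, hpq⟩ := hnhds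
  obtain ⟨ε, hε, hball⟩ := Metric.eventually_nhds_iff.1 hp
  have hlim := (h.tendsto_measure_mean_near hi hε).comp (tendsto_natCeil_mul ha)
  refine tendsto_of_tendsto_of_tendsto_of_le_of_le' hlim tendsto_const_nhds ?_
    (.of_forall fun _ => prob_le_one)
  filter_upwards [(tendsto_natCeil_mul_div ha.le).eventually hq, eventually_gt_atTop 0,
    (tendsto_natCeil_mul ha).eventually (eventually_gt_atTop 0)] with θ hθ hθ0 hn
  refine measure_mono fun ω hω => ?_
  have := hpq (hball (y := (∑ i ∈ Finset.range ⌈a * θ⌉₊, x i ω) / ⌈a * θ⌉₊)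
    (by simpa [Real.dist_eq] using hω)) hθ
  have hn' : (0 : ℝ) < ⌈a * θ⌉₊ := by exact_mod_cast hn
  have e : (⌈a * θ⌉₊ : ℝ) / θ * ((∑ i ∈ Finset.range ⌈a * θ⌉₊, x i ω) / ⌈a * θ⌉₊) =
      (∑ i ∈ Finset.range ⌈a * θ⌉₊, x i ω) / θ := by field_simp
  rw [e, lt_div_iff₀ hθ0, div_lt_iff₀ hθ0] at this
  exact ⟨this.1, this.2.le⟩

end ChangeOfMeasure

/-! ### Growth of the mean alarm times as θ → ∞. -/

section Asymptotics

variable {Ω : Type*} [MeasurableSpace Ω]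

/-- The expected alarm time with threshold `θ`, as the sum of its tail probabilities. -/
noncomputable def meanAlarm (x : ℕ → Ω → ℝ) (Q : Measure Ω) (θ : ℝ) : ℝ≥0∞ :=
  ∑' n, Q {ω | Quiet θ (fun i => x i ω) n}

lemma meanAlarm_mono (x : ℕ → Ω → ℝ) (Q : Measure Ω) : Monotone (meanAlarm x Q) :=
  fun _ _ h => ENNReal.tsum_le_tsum fun _ => measure_mono fun _ hω => Quiet.mono_threshold hω h

variable {x : ℕ → Ω → ℝ} {μ₀ μ₁ : Measure ℝ} {P₀ P₁ : Measure Ω}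

lemma eventually_meanAlarm_alt_le (h₁ : IsIID x μ₁ P₁) (hi : Integrable id μ₁)
    (hΦ : 0 < ∫ y, y ∂μ₁) {a : ℝ} (ha : 1 / ∫ y, y ∂μ₁ < a) :
    ∀ᶠ θ : ℝ in atTop, meanAlarm x P₁ θ ≤ ENNReal.ofReal (a * θ) := by
  have hP₁ := h₁.indep.isProbabilityMeasure
  obtain ⟨b, hb, hba⟩ := exists_between ha
  have hb0 : 0 < b := lt_trans (by positivity) hb
  have hbΦ : 1 < b * ∫ y, y ∂μ₁ := by rwa [div_lt_iff₀ hΦ] at hb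
  have h := h₁.tendsto_measure_sum_mem_Ioc hi hb0 hbΦ (lt_add_one _)
  -- With n = ⌈bθ⌉, rounding is absorbed by n ≤ qθ and the random error by P₁(S_n > θ) ≥ q/a, so
  -- that n / P₁(S_n > θ) ≤ aθ.
  obtain ⟨q, hq, hqa⟩ := exists_between hba
  have hq0 : 0 < q := hb0.trans hq
  have hr : ENNReal.ofReal (q / a) < 1 := by
    rw [ENNReal.ofReal_lt_one, div_lt_one (hq0.trans hqa)]; exact hqa
  filter_upwards [h.eventually (lt_mem_nhds hr),
    (tendsto_natCeil_mul_div hb0.le).eventually (gt_mem_nhds hq), eventually_gt_atTop 0,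
    (tendsto_natCeil_mul hb0).eventually (eventually_gt_atTop 0)] with θ h1 h2 hθ hn
  have hle : ENNReal.ofReal (q / a) ≤ P₁ {ω | θ < ∑ i ∈ Finset.range ⌈b * θ⌉₊, x i ω} :=
    h1.le.trans (measure_mono fun ω hω => by simpa using hω.1)
  refine (h₁.tsum_measure_quiet_le θ hn.ne').trans ?_
  have ha0 : 0 < a := hq0.trans hqa
  calc _ ≤ ENNReal.ofReal (q * θ) * (ENNReal.ofReal (q / a))⁻¹ := by
        gcongr
        rw [← ENNReal.ofReal_natCast]
        rw [div_lt_iff₀ hθ] at h2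
        exact ENNReal.ofReal_le_ofReal h2.le
    _ = ENNReal.ofReal (a * θ) := by
        rw [← ENNReal.ofReal_inv_of_pos (by positivity), ← ENNReal.ofReal_mul (by positivity)]
        congr 1
        field_simp

/-- Let n = ⌈bθ/Φ⌉ with 1 < b < d < c. Under `P₁` the sum S_n lies in (θ, dθ] with probability above
1/2, so changing measure gives P₀(S_n > θ) ≥ e^{-dθ}/2. The block bound applies with this n. -/
lemma eventually_meanAlarm_null_le (h₀ : IsIID x μ₀ P₀) (h₁ : IsIID x μ₁ P₁)
    (hμ : μ₁ = μ₀.withDensity fun y => ENNReal.ofReal (Real.exp y)) (hi : Integrable id μ₁)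
    (hΦ : 0 < ∫ y, y ∂μ₁) {c : ℝ} (hc : 1 < c) :
    ∀ᶠ θ : ℝ in atTop, meanAlarm x P₀ θ ≤ ENNReal.ofReal (Real.exp (c * θ)) := by
  have hP₀ := h₀.indep.isProbabilityMeasure
  obtain ⟨d, hd1, hdc⟩ := exists_between hc
  obtain ⟨b, hb1, hbd⟩ := exists_between hd1
  set a := b / ∫ y, y ∂μ₁ with ha
  have haΦ : a * ∫ y, y ∂μ₁ = b := by rw [ha]; field_simp
  have ha0 : 0 < a := by rw [ha]; positivity
  have h := h₁.tendsto_measure_sum_mem_Ioc hi ha0 (b := 1) (c := d) (by rwa [haΦ]) (by rwa [haΦ])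
  have hr : ENNReal.ofReal (1 / 2) < 1 := by rw [ENNReal.ofReal_lt_one]; norm_num
  -- The gap between d and c absorbs the linear factor: n ≤ (a + 1)θ, and the 2 comes from the
  -- probability 1/2.
  have hgrow : ∀ᶠ θ : ℝ in atTop, 2 * (a + 1) * θ ≤ Real.exp ((c - d) * θ) := by
    have h1 : Tendsto (fun θ : ℝ => Real.exp ((c - d) * θ) / ((c - d) * θ) ^ 1) atTop atTop :=
      (Real.tendsto_exp_div_pow_atTop 1).comp (tendsto_id.const_mul_atTop (by linarith))
    filter_upwards [h1.eventually (eventually_ge_atTop (2 * (a + 1) / (c - d))),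
      eventually_gt_atTop 0] with θ h2 hθ
    have hcd : 0 < c - d := by linarith
    rw [pow_one, le_div_iff₀ (by positivity)] at h2
    calc 2 * (a + 1) * θ = 2 * (a + 1) / (c - d) * ((c - d) * θ) := by field_simp
      _ ≤ _ := h2
  filter_upwards [h.eventually (lt_mem_nhds hr), hgrow,
    (tendsto_natCeil_mul_div ha0.le).eventually (gt_mem_nhds (lt_add_one a)), eventually_gt_atTop 0,
    (tendsto_natCeil_mul ha0).eventually (eventually_gt_atTop 0)] with θ h1 h2 h3 hθ hn
  rw [div_lt_iff₀ hθ] at h3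
  have hmeas : MeasurableSet[MeasurableSpace.comap (fun ω (i : Fin ⌈a * θ⌉₊) => x i ω)
      inferInstance] {ω | ∑ i ∈ Finset.range ⌈a * θ⌉₊, x i ω ≤ θ}ᶜ :=
    @MeasurableSet.compl Ω _ (MeasurableSpace.comap (fun ω (i : Fin ⌈a * θ⌉₊) => x i ω)
      inferInstance) (@measurableSet_sum_le Ω
        (MeasurableSpace.comap (fun ω (i : Fin ⌈a * θ⌉₊) => x i ω) inferInstance) x
        (Finset.range ⌈a * θ⌉₊)
        (fun i hi => measurable_comap_fin x (Finset.mem_range.1 hi)) θ)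
  have hcm := measure_inter_le_exp_mul h₀ h₁ hμ hmeas (d * θ)
  have hset : {ω | ∑ i ∈ Finset.range ⌈a * θ⌉₊, x i ω ≤ θ}ᶜ =
      {ω | θ < ∑ i ∈ Finset.range ⌈a * θ⌉₊, x i ω} := by ext ω; simp
  rw [hset] at hcm
  have hlow : ENNReal.ofReal (1 / 2 * Real.exp (-(d * θ))) ≤
      P₀ {ω | θ < ∑ i ∈ Finset.range ⌈a * θ⌉₊, x i ω} := by
    have h4 : ENNReal.ofReal (1 / 2) ≤ ENNReal.ofReal (Real.exp (d * θ)) *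
        P₀ {ω | θ < ∑ i ∈ Finset.range ⌈a * θ⌉₊, x i ω} :=
      (h1.le.trans (measure_mono fun ω hω => by
        exact ⟨by simpa using hω.1, hω.2⟩)).trans hcm
    calc _ = ENNReal.ofReal (Real.exp (-(d * θ))) * ENNReal.ofReal (1 / 2) := by
          rw [← ENNReal.ofReal_mul (Real.exp_pos _).le, mul_comm]
      _ ≤ ENNReal.ofReal (Real.exp (-(d * θ))) * (ENNReal.ofReal (Real.exp (d * θ)) *
        P₀ {ω | θ < ∑ i ∈ Finset.range ⌈a * θ⌉₊, x i ω}) := by gcongr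
      _ = _ := by
          rw [← mul_assoc, ← ENNReal.ofReal_mul (Real.exp_pos _).le, ← Real.exp_add,
            neg_add_cancel, Real.exp_zero, ENNReal.ofReal_one, one_mul]
  refine (h₀.tsum_measure_quiet_le θ hn.ne').trans ?_
  calc _ ≤ ENNReal.ofReal ((a + 1) * θ) * (ENNReal.ofReal (1 / 2 * Real.exp (-(d * θ))))⁻¹ := by
        gcongr
        rw [← ENNReal.ofReal_natCast]
        exact ENNReal.ofReal_le_ofReal h3.le
    _ = ENNReal.ofReal (2 * (a + 1) * θ * Real.exp (d * θ)) := by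
        rw [← ENNReal.ofReal_inv_of_pos (by positivity), ← ENNReal.ofReal_mul (by positivity)]
        congr 1
        rw [Real.exp_neg]
        field_simp
    _ ≤ ENNReal.ofReal (Real.exp ((c - d) * θ) * Real.exp (d * θ)) := by gcongr
    _ = _ := by rw [← Real.exp_add]; congr 2; ring

lemma lintegral_exp_eq_one (h₁ : IsIID x μ₁ P₁)
    (hμ : μ₁ = μ₀.withDensity fun y => ENNReal.ofReal (Real.exp y)) :
    ∫⁻ y, ENNReal.ofReal (Real.exp y) ∂μ₀ = 1 := by
  have := h₁.isProbabilityMeasure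
  rw [← setLIntegral_univ, ← withDensity_apply _ MeasurableSet.univ, ← hμ, measure_univ]

/-- Let n = ⌈bθ⌉ with a < b < 1/Φ. An alarm by time n has `P₀`-probability at most n e^{-θ}, and S_n
≤ cθ for some c < 1 with `P₁`-probability tending to 1. Hence its `P₁`-probability is at most n
e^{-(1-c)θ} + o(1), and E₁τ ≥ n P₁(τ > n) ≥ bθ · (a/b). -/
lemma eventually_le_meanAlarm_alt (h₀ : IsIID x μ₀ P₀) (h₁ : IsIID x μ₁ P₁)
    (hμ : μ₁ = μ₀.withDensity fun y => ENNReal.ofReal (Real.exp y)) (hi : Integrable id μ₁)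
    (hΦ : 0 < ∫ y, y ∂μ₁) {a : ℝ} (ha0 : 0 < a) (ha : a < 1 / ∫ y, y ∂μ₁) :
    ∀ᶠ θ : ℝ in atTop, ENNReal.ofReal (a * θ) ≤ meanAlarm x P₁ θ := by
  have hP₀ := h₀.indep.isProbabilityMeasure
  obtain ⟨b, hab, hb⟩ := exists_between ha
  have hb0 : 0 < b := ha0.trans hab
  have hbΦ : b * ∫ y, y ∂μ₁ < 1 := by rwa [lt_div_iff₀ hΦ] at hb
  obtain ⟨c, hbc, hc⟩ := exists_between hbΦ
  -- Only the upper end of the window matters; the lower end is an arbitrary number below the mean.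
  have h := h₁.tendsto_measure_sum_mem_Ioc hi hb0 (sub_one_lt _) hbc
  have hzero : Tendsto (fun θ : ℝ => ENNReal.ofReal ((b + 1) * θ * Real.exp (-((1 - c) * θ))))
      atTop (𝓝 0) := by
    have h1 : Tendsto (fun θ : ℝ => ((1 - c) * θ) ^ 1 * Real.exp (-((1 - c) * θ))) atTop (𝓝 0) :=
      (Real.tendsto_pow_mul_exp_neg_atTop_nhds_zero 1).comp
        (tendsto_id.const_mul_atTop (by linarith))
    have h2 := (h1.const_mul ((b + 1) / (1 - c)))
    rw [mul_zero] at h2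
    rw [← ENNReal.ofReal_zero]
    refine ENNReal.tendsto_ofReal (h2.congr fun θ => ?_)
    have : 1 - c ≠ 0 := by linarith
    field_simp
  have hlim : Tendsto (fun θ : ℝ => P₁ {ω | (b * ∫ y, y ∂μ₁ - 1) * θ <
      ∑ i ∈ Finset.range ⌈b * θ⌉₊, x i ω ∧ ∑ i ∈ Finset.range ⌈b * θ⌉₊, x i ω ≤ c * θ} -
      ENNReal.ofReal ((b + 1) * θ * Real.exp (-((1 - c) * θ)))) atTop (𝓝 (1 - 0)) :=
    ENNReal.Tendsto.sub h hzero (by simp)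
  rw [tsub_zero] at hlim
  have hr : ENNReal.ofReal (a / b) < 1 := by
    rw [ENNReal.ofReal_lt_one, div_lt_one hb0]; exact hab
  filter_upwards [hlim.eventually (lt_mem_nhds hr),
    (tendsto_natCeil_mul_div hb0.le).eventually (gt_mem_nhds (lt_add_one b)),
    eventually_gt_atTop 0] with θ h1 h2 hθ
  rw [div_lt_iff₀ hθ] at h2
  set n := ⌈b * θ⌉₊ with hn
  have mQ : MeasurableSet {ω | Quiet θ (fun i => x i ω) n} :=
    measurableSet_quiet (fun i _ => h₀.measurable i) θ
  have hmeas : MeasurableSet[MeasurableSpace.comap (fun ω (i : Fin n) => x i ω)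
      inferInstance] {ω | Quiet θ (fun i => x i ω) n}ᶜ :=
    @MeasurableSet.compl Ω _ (MeasurableSpace.comap (fun ω (i : Fin n) => x i ω)
      inferInstance) (@measurableSet_quiet Ω
        (MeasurableSpace.comap (fun ω (i : Fin n) => x i ω) inferInstance) x n
        (fun i hi => measurable_comap_fin x hi) θ)
  have hcm := measure_inter_le_exp_mul h₀ h₁ hμ hmeas (c * θ)
  -- Lorden's truncated inequality with every probability on the right bounded by 1, so the sum is
  -- at most n.
  have hnull : P₀ {ω | Quiet θ (fun i => x i ω) n}ᶜ ≤
      ENNReal.ofReal ((b + 1) * θ * Real.exp (-θ)) := by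
    have h3 : ENNReal.ofReal (Real.exp θ) * P₀ {ω | Quiet θ (fun i => x i ω) n}ᶜ ≤ n := by
      refine (h₀.exp_mul_measure_compl_quiet_le (lintegral_exp_eq_one h₁ hμ) θ n).trans ?_
      refine (Finset.sum_le_sum fun i _ => prob_le_one).trans ?_
      simp
    calc _ = ENNReal.ofReal (Real.exp (-θ)) * (ENNReal.ofReal (Real.exp θ) *
        P₀ {ω | Quiet θ (fun i => x i ω) n}ᶜ) := by
          rw [← mul_assoc, ← ENNReal.ofReal_mul (Real.exp_pos _).le, ← Real.exp_add,
            neg_add_cancel, Real.exp_zero, ENNReal.ofReal_one, one_mul]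
      _ ≤ ENNReal.ofReal (Real.exp (-θ)) * n := by gcongr
      _ ≤ ENNReal.ofReal (Real.exp (-θ)) * ENNReal.ofReal ((b + 1) * θ) := by
          gcongr
          rw [← ENNReal.ofReal_natCast]
          exact ENNReal.ofReal_le_ofReal h2.le
      _ = _ := by rw [← ENNReal.ofReal_mul (Real.exp_pos _).le, mul_comm]
  have hsmall : P₁ ({ω | Quiet θ (fun i => x i ω) n}ᶜ ∩
      {ω | ∑ i ∈ Finset.range n, x i ω ≤ c * θ}) ≤
      ENNReal.ofReal ((b + 1) * θ * Real.exp (-((1 - c) * θ))) := by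
    refine hcm.trans ?_
    calc _ ≤ ENNReal.ofReal (Real.exp (c * θ)) * ENNReal.ofReal ((b + 1) * θ * Real.exp (-θ)) := by
          gcongr
      _ = _ := by
          rw [← ENNReal.ofReal_mul (Real.exp_pos _).le]
          congr 1
          rw [show -((1 - c) * θ) = c * θ + -θ by ring, Real.exp_add]
          ring
  have hquiet : ENNReal.ofReal (a / b) ≤ P₁ {ω | Quiet θ (fun i => x i ω) n} := by
    refine h1.le.trans (tsub_le_iff_right.2 ?_)
    refine le_trans ?_ (add_le_add_right hsmall _)
    refine (measure_mono fun ω hω => ?_).trans (measure_union_le _ _)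
    by_cases hω' : Quiet θ (fun i => x i ω) n
    · exact Or.inl hω'
    · exact Or.inr ⟨hω', hω.2⟩
  calc ENNReal.ofReal (a * θ) = ENNReal.ofReal (b * θ) * ENNReal.ofReal (a / b) := by
        rw [← ENNReal.ofReal_mul (by positivity)]
        congr 1
        field_simp
    _ ≤ n * P₁ {ω | Quiet θ (fun i => x i ω) n} := by
        gcongr
        rw [← ENNReal.ofReal_natCast]
        exact ENNReal.ofReal_le_ofReal (Nat.le_ceil _)
    _ = ∑ _j ∈ Finset.range n, P₁ {ω | Quiet θ (fun i => x i ω) n} := by simp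
    _ ≤ ∑ j ∈ Finset.range n, P₁ {ω | Quiet θ (fun i => x i ω) j} :=
        Finset.sum_le_sum fun j hj =>
          antitone_measure_quiet x P₁ θ (Finset.mem_range.1 hj).le
    _ ≤ _ := ENNReal.sum_le_tsum _

/-- The bounds are available for large θ; monotonicity in the threshold carries finiteness down to
every θ. -/
lemma meanAlarm_alt_ne_top (h₁ : IsIID x μ₁ P₁) (hi : Integrable id μ₁)
    (hΦ : 0 < ∫ y, y ∂μ₁) (θ : ℝ) : meanAlarm x P₁ θ ≠ ⊤ := by
  obtain ⟨θ', h, hθ⟩ := ((eventually_meanAlarm_alt_le h₁ hi hΦ (lt_add_one _)).and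
    (eventually_ge_atTop θ)).exists
  exact ne_top_of_le_ne_top ENNReal.ofReal_ne_top ((meanAlarm_mono x P₁ hθ).trans h)

lemma meanAlarm_null_ne_top (h₀ : IsIID x μ₀ P₀) (h₁ : IsIID x μ₁ P₁)
    (hμ : μ₁ = μ₀.withDensity fun y => ENNReal.ofReal (Real.exp y)) (hi : Integrable id μ₁)
    (hΦ : 0 < ∫ y, y ∂μ₁) (θ : ℝ) : meanAlarm x P₀ θ ≠ ⊤ := by
  obtain ⟨θ', h, hθ⟩ := ((eventually_meanAlarm_null_le h₀ h₁ hμ hi hΦ one_lt_two).and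
    (eventually_ge_atTop θ)).exists
  exact ne_top_of_le_ne_top ENNReal.ofReal_ne_top ((meanAlarm_mono x P₀ hθ).trans h)

lemma tendsto_meanAlarm_alt_div (h₀ : IsIID x μ₀ P₀) (h₁ : IsIID x μ₁ P₁)
    (hμ : μ₁ = μ₀.withDensity fun y => ENNReal.ofReal (Real.exp y)) (hi : Integrable id μ₁)
    (hΦ : 0 < ∫ y, y ∂μ₁) :
    Tendsto (fun θ => (meanAlarm x P₁ θ).toReal / θ) atTop (𝓝 (1 / ∫ y, y ∂μ₁)) := by
  have hpos : 0 < 1 / ∫ y, y ∂μ₁ := by positivity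
  rw [tendsto_order]
  refine ⟨fun a ha => ?_, fun a ha => ?_⟩
  · obtain ⟨b, hb, hb'⟩ := exists_between (max_lt ha hpos)
    filter_upwards [eventually_le_meanAlarm_alt h₀ h₁ hμ hi hΦ ((le_max_right _ _).trans_lt hb) hb',
      eventually_gt_atTop 0] with θ h hθ
    rw [lt_div_iff₀ hθ]
    have := (ENNReal.ofReal_le_iff_le_toReal (meanAlarm_alt_ne_top h₁ hi hΦ θ)).1 h
    have hab : a < b := (le_max_left _ _).trans_lt hb
    exact (mul_lt_mul_of_pos_right hab hθ).trans_le this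
  · obtain ⟨b, hb, hba⟩ := exists_between ha
    filter_upwards [eventually_meanAlarm_alt_le h₁ hi hΦ hb, eventually_gt_atTop 0] with θ h hθ
    rw [div_lt_iff₀ hθ]
    have hb0 : 0 < b := hpos.trans hb
    exact (ENNReal.toReal_le_of_le_ofReal (by positivity) h).trans_lt
      (mul_lt_mul_of_pos_right hba hθ)

lemma tendsto_log_meanAlarm_null_div (h₀ : IsIID x μ₀ P₀) (h₁ : IsIID x μ₁ P₁)
    (hμ : μ₁ = μ₀.withDensity fun y => ENNReal.ofReal (Real.exp y)) (hi : Integrable id μ₁)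
    (hΦ : 0 < ∫ y, y ∂μ₁) :
    Tendsto (fun θ => Real.log (meanAlarm x P₀ θ).toReal / θ) atTop (𝓝 1) := by
  have hP₀ := h₀.indep.isProbabilityMeasure
  have hfin := meanAlarm_null_ne_top h₀ h₁ hμ hi hΦ
  have hlow : ∀ θ, Real.exp θ ≤ (meanAlarm x P₀ θ).toReal := fun θ =>
    (ENNReal.ofReal_le_iff_le_toReal (hfin θ)).1
      (h₀.exp_le_tsum_measure_quiet (lintegral_exp_eq_one h₁ hμ) θ)
  rw [tendsto_order]
  refine ⟨fun a ha => ?_, fun a ha => ?_⟩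
  · filter_upwards [eventually_gt_atTop 0] with θ hθ
    rw [lt_div_iff₀ hθ]
    have := (Real.le_log_iff_exp_le ((Real.exp_pos θ).trans_le (hlow θ))).2 (hlow θ)
    nlinarith
  · obtain ⟨b, hb, hba⟩ := exists_between ha
    filter_upwards [eventually_meanAlarm_null_le h₀ h₁ hμ hi hΦ hb, eventually_gt_atTop 0]
      with θ h hθ
    rw [div_lt_iff₀ hθ]
    have h2 := ENNReal.toReal_le_of_le_ofReal (Real.exp_pos _).le h
    have h3 := (Real.log_le_iff_le_exp ((Real.exp_pos θ).trans_le (hlow θ))).2 h2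
    exact h3.trans_lt (mul_lt_mul_of_pos_right hba hθ)

/-- The ratio of the mean detection delay to the logarithm of the mean time to a false alarm. -/
lemma tendsto_delay_div_log_meanAlarm (h₀ : IsIID x μ₀ P₀) (h₁ : IsIID x μ₁ P₁)
    (hμ : μ₁ = μ₀.withDensity fun y => ENNReal.ofReal (Real.exp y)) (hi : Integrable id μ₁)
    (hΦ : 0 < ∫ y, y ∂μ₁) :
    Tendsto (fun θ => ((meanAlarm x P₁ θ).toReal - 1) / Real.log (meanAlarm x P₀ θ).toReal) atTop
      (𝓝 (1 / ∫ y, y ∂μ₁)) := by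
  -- The subtracted 1 is the change time ν = 1, from which the delay is counted; divided by θ it
  -- vanishes in the limit.
  have h := ((tendsto_meanAlarm_alt_div h₀ h₁ hμ hi hΦ).sub tendsto_inv_atTop_zero).div
    (tendsto_log_meanAlarm_null_div h₀ h₁ hμ hi hΦ) one_ne_zero
  rw [sub_zero, div_one] at h
  refine h.congr' ?_
  filter_upwards [eventually_gt_atTop 0] with θ hθ
  simp only [Pi.div_apply]
  rw [← one_div, ← sub_div, div_div_div_cancel_right₀ hθ.ne']

end Asymptotics

/-! ### Alarm time, false alarm rate and delay as sums of tail probabilities. -/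

section AlarmTime

lemma sum_Icc_pnat_eq (f : ℕ+ → ℝ) (p j : ℕ+) :
    ∑ i ∈ Finset.Icc p j, f i = ∑ k ∈ Finset.Ico p.natPred j, f k.succPNat := by
  refine Finset.sum_nbij' PNat.natPred Nat.succPNat ?_ ?_ ?_ ?_ ?_
  · intro i hi
    have hi := Finset.mem_Icc.1 hi
    have h1 := PNat.coe_le_coe p i |>.2 hi.1
    have h2 := PNat.coe_le_coe i j |>.2 hi.2
    have h3 := PNat.natPred_add_one i
    have h4 := PNat.natPred_add_one p
    rw [Finset.mem_Ico]
    omega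
  · intro k hk
    have hk := Finset.mem_Ico.1 hk
    have h4 := PNat.natPred_add_one p
    rw [Finset.mem_Icc, ← PNat.coe_le_coe, ← PNat.coe_le_coe, Nat.succPNat_coe]
    omega
  · intro i _; exact PNat.succPNat_natPred i
  · intro k _; exact Nat.natPred_succPNat k
  · intro i _; rw [PNat.succPNat_natPred]

/-- The bridge from the detector to `Quiet`. Term `k` is the sample at time `k + 1`, so the window
from time `p + 1` to time `j` becomes `Finset.Ico p j`. -/
lemma natCast_lt_alarmTime {ι : Type*} [Fintype ι] [DecidableEq ι] (A₀ A₁ : Matrix ι ι ℂ) (θ : ℝ)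
    (h : ℕ+ → ι → ℂ) (n : ℕ) :
    (n : ℕ∞) < alarmTime A₀ A₁ θ h ↔ Quiet θ (fun k => llr A₀ A₁ (h k.succPNat)) n := by
  rw [← Order.add_one_le_iff_of_not_isMax (by simp), alarmTime, le_iInf₂_iff]
  have hc : ∀ j : ℕ+, cusum A₀ A₁ h j ≤ θ ↔
      ∀ p < (j : ℕ), ∑ k ∈ Finset.Ico p j, llr A₀ A₁ (h k.succPNat) ≤ θ := by
    intro j
    rw [cusum, Finset.sup'_le_iff]
    constructor
    · intro H p hp
      have := H p.succPNat (Finset.mem_Icc.2 ⟨one_le, by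
        rw [← PNat.coe_le_coe, Nat.succPNat_coe]; omega⟩)
      rwa [sum_Icc_pnat_eq (fun i => llr A₀ A₁ (h i)), Nat.natPred_succPNat] at this
    · intro H p hp
      rw [sum_Icc_pnat_eq (fun i => llr A₀ A₁ (h i))]
      have h1 := PNat.coe_le_coe p j |>.2 (Finset.mem_Icc.1 hp).2
      have h2 := PNat.natPred_add_one p
      exact H _ (by omega)
  constructor
  · intro H j hj p hp
    have hj0 : 0 < j := by omega
    have hle : cusum A₀ A₁ h ⟨j, hj0⟩ ≤ θ := by
      by_contra hlt
      have := H ⟨j, hj0⟩ (not_le.1 hlt)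
      simp only [PNat.mk_coe] at this
      have h2 : n + 1 ≤ j := by exact_mod_cast this
      omega
    exact (hc _).1 hle p hp
  · intro H j hj
    have : ¬ (j : ℕ) ≤ n := fun hjn => not_le.2 hj ((hc j).2 (H j hjn))
    have h2 : n + 1 ≤ (j : ℕ) := by omega
    exact_mod_cast h2

lemma tsum_ite_lt_enat (t : ℕ∞) (k : ℕ) :
    ∑' n : ℕ, (if ((n + k : ℕ) : ℕ∞) < t then (1 : ℝ≥0∞) else 0) = (t : ℝ≥0∞) - k := by
  induction t using ENat.recTopCoe with
  | top =>
    simp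
  | coe a =>
    have : ∀ n : ℕ, (if ((n + k : ℕ) : ℕ∞) < (a : ℕ∞) then (1 : ℝ≥0∞) else 0) =
        if n ∈ Finset.range (a - k) then 1 else 0 := by
      intro n
      congr 1
      rw [Nat.cast_lt, Finset.mem_range]
      exact propext (by omega)
    simp_rw [this]
    rw [tsum_eq_sum (s := Finset.range (a - k)) (fun n hn => if_neg hn),
      Finset.sum_congr rfl fun n hn => if_pos hn]
    simp

variable {Ω : Type*} [MeasurableSpace Ω] {x : ℕ → Ω → ℝ} {θ : ℝ} {τ : Ω → ℕ∞}

lemma setLIntegral_alarm_sub {Q : Measure Ω} (hx : ∀ i, Measurable (x i))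
    (hτ : ∀ ω (n : ℕ), (n : ℕ∞) < τ ω ↔ Quiet θ (fun i => x i ω) n) (k : ℕ) (A : Set Ω) :
    ∫⁻ ω in A, ((τ ω : ℝ≥0∞) - k) ∂Q =
      ∑' n : ℕ, Q ({ω | Quiet θ (fun i => x i ω) (n + k)} ∩ A) := by
  have hm : ∀ n, MeasurableSet {ω | Quiet θ (fun i => x i ω) n} := fun n =>
    measurableSet_quiet (fun i _ => hx i) θ
  classical
  have key : ∀ ω, (τ ω : ℝ≥0∞) - k =
      ∑' n : ℕ, {ω | Quiet θ (fun i => x i ω) (n + k)}.indicator (fun _ => (1 : ℝ≥0∞)) ω := by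
    intro ω
    rw [← tsum_ite_lt_enat]
    refine tsum_congr fun n => ?_
    rw [Set.indicator_apply]
    exact if_congr (hτ ω _) rfl rfl
  simp_rw [key]
  rw [lintegral_tsum fun n => (measurable_const.indicator (hm _)).aemeasurable]
  refine tsum_congr fun n => ?_
  rw [lintegral_indicator (hm _), setLIntegral_one, Measure.restrict_apply (hm _)]

lemma lintegral_alarm {Q : Measure Ω} (hx : ∀ i, Measurable (x i))
    (hτ : ∀ ω (n : ℕ), (n : ℕ∞) < τ ω ↔ Quiet θ (fun i => x i ω) n) :
    ∫⁻ ω, (τ ω : ℝ≥0∞) ∂Q = meanAlarm x Q θ := by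
  have := setLIntegral_alarm_sub (Q := Q) hx hτ 0 Set.univ
  simpa [meanAlarm] using this

lemma measurable_alarm (hx : ∀ i, Measurable (x i))
    (hτ : ∀ ω (n : ℕ), (n : ℕ∞) < τ ω ↔ Quiet θ (fun i => x i ω) n) :
    Measurable fun ω => (τ ω : ℝ≥0∞) := by
  classical
  have key : ∀ ω, (τ ω : ℝ≥0∞) =
      ∑' n : ℕ, {ω | Quiet θ (fun i => x i ω) n}.indicator (fun _ => (1 : ℝ≥0∞)) ω := by
    intro ω
    have := tsum_ite_lt_enat (τ ω) 0
    simp only [Nat.cast_zero, tsub_zero, add_zero] at this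
    rw [← this]
    refine tsum_congr fun n => ?_
    rw [Set.indicator_apply]
    exact if_congr (hτ ω _) rfl rfl
  rw [funext key]
  exact Measurable.tsum fun n =>
    measurable_const.indicator (measurableSet_quiet (fun i _ => hx i) θ)

lemma ae_alarm_lt_top {Q : Measure Ω} (hx : ∀ i, Measurable (x i))
    (hτ : ∀ ω (n : ℕ), (n : ℕ∞) < τ ω ↔ Quiet θ (fun i => x i ω) n)
    (hfin : meanAlarm x Q θ ≠ ⊤) : ∀ᵐ ω ∂Q, τ ω < ⊤ := by
  rw [← lintegral_alarm hx hτ] at hfin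
  filter_upwards [ae_lt_top (measurable_alarm hx hτ) hfin] with ω hω
  rw [lt_top_iff_ne_top] at hω ⊢
  intro h
  simp [h] at hω

/-- A finite mean makes the alarm almost surely finite, so the conditioning has no effect. -/
lemma falseAlarmRate_eq {P : WithTop ℕ+ → Measure Ω} [IsProbabilityMeasure (P ⊤)]
    (hx : ∀ i, Measurable (x i))
    (hτ : ∀ ω (n : ℕ), (n : ℕ∞) < τ ω ↔ Quiet θ (fun i => x i ω) n)
    (hfin : meanAlarm x (P ⊤) θ ≠ ⊤) :
    falseAlarmRate P τ = (meanAlarm x (P ⊤) θ)⁻¹ := by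
  have hae := ae_alarm_lt_top hx hτ hfin
  have hu : {ω | τ ω < ⊤} =ᵐ[P ⊤] Set.univ := eventuallyEq_univ.2 hae
  have h1 : P ⊤ {ω | τ ω < ⊤} = 1 := by rw [measure_congr hu, measure_univ]
  rw [falseAlarmRate, ProbabilityTheory.cond, h1, inv_one, one_smul,
    Measure.restrict_congr_set hu, Measure.restrict_univ, lintegral_alarm hx hτ]

/-- The change time is ν = m + 1: the event τ ≥ ν is τ > m, and τ - ν counts the n with τ > ν + n =
m + (n + 1). -/
lemma delay_eq_tsum {P : WithTop ℕ+ → Measure Ω} (hx : ∀ i, Measurable (x i))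
    (hτ : ∀ ω (n : ℕ), (n : ℕ∞) < τ ω ↔ Quiet θ (fun i => x i ω) n) (m : ℕ) :
    delayAt P τ m.succPNat = (P m.succPNat {ω | Quiet θ (fun i => x i ω) m})⁻¹ *
      ∑' n : ℕ, P m.succPNat {ω | Quiet θ (fun i => x i ω) (m + (n + 1))} := by
  have hA : {ω | (((m.succPNat : ℕ+) : ℕ) : ℕ∞) ≤ τ ω} = {ω | Quiet θ (fun i => x i ω) m} := by
    ext ω
    simp only [Set.mem_ofPred_eq, ← hτ]
    rw [← Order.add_one_le_iff_of_not_isMax (by simp)]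
    simp
  rw [delayAt, hA, ProbabilityTheory.cond, lintegral_smul_measure, smul_eq_mul,
    setLIntegral_alarm_sub hx hτ]
  congr 1
  refine tsum_congr fun n => ?_
  rw [Nat.succPNat_coe, show n + m.succ = m + (n + 1) by omega]
  congr 1
  exact Set.inter_eq_self_of_subset_left fun ω hω => Quiet.mono hω (Nat.le_add_right _ _)

/-- Forgetting the first `m` samples removes windows and so can only postpone the alarm. The
restarted sequence is independent of the conditioning event and distributed as under `P₁`. -/
lemma delayAt_succPNat_le {P : WithTop ℕ+ → Measure Ω} {P₁ : Measure Ω} {μ₁ : Measure ℝ} {m : ℕ}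
    (hτ : ∀ ω (n : ℕ), (n : ℕ∞) < τ ω ↔ Quiet θ (fun i => x i ω) n)
    (h₁ : IsIID x μ₁ P₁) (hind : iIndepFun x (P m.succPNat))
    (htail : IsIID (fun i => x (m + i)) μ₁ (P m.succPNat)) :
    delayAt P τ m.succPNat ≤ ∑' n : ℕ, P₁ {ω | Quiet θ (fun i => x i ω) (n + 1)} := by
  have hQ := hind.isProbabilityMeasure
  rw [delay_eq_tsum h₁.measurable hτ m]
  calc _ ≤ (P m.succPNat {ω | Quiet θ (fun i => x i ω) m})⁻¹ *
        ∑' n : ℕ, P m.succPNat {ω | Quiet θ (fun i => x i ω) m} *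
          P₁ {ω | Quiet θ (fun i => x i ω) (n + 1)} := by
        gcongr with n
        rw [← htail.measure_quiet_eq h₁, ← measure_quiet_inter_shift h₁.measurable hind]
        exact measure_mono fun ω hω => ⟨Quiet.mono hω (Nat.le_add_right _ _), Quiet.shift hω⟩
    _ ≤ _ := by
        rw [ENNReal.tsum_mul_left, ← mul_assoc]
        -- This also covers a conditioning event of probability 0, where `0⁻¹ * 0 = 0`.
        exact mul_le_of_le_one_left zero_le (ENNReal.inv_mul_le_one _)

lemma delayAt_one_eq {P : WithTop ℕ+ → Measure Ω} [IsProbabilityMeasure (P (1 : ℕ+))]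
    (hx : ∀ i, Measurable (x i))
    (hτ : ∀ ω (n : ℕ), (n : ℕ∞) < τ ω ↔ Quiet θ (fun i => x i ω) n) :
    delayAt P τ 1 = ∑' n : ℕ, P (1 : ℕ+) {ω | Quiet θ (fun i => x i ω) (n + 1)} := by
  have h := delay_eq_tsum (P := P) hx hτ 0
  have h1 : Nat.succPNat 0 = 1 := rfl
  have hu : {ω | Quiet θ (fun i => x i ω) 0} = Set.univ := by
    ext ω; simp [quiet_zero]
  simp only [h1, hu, measure_univ, inv_one, one_mul, zero_add] at h
  exact h

lemma meanAlarm_eq_one_add (x : ℕ → Ω → ℝ) (Q : Measure Ω) [IsProbabilityMeasure Q] (θ : ℝ) :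
    meanAlarm x Q θ = 1 + ∑' n : ℕ, Q {ω | Quiet θ (fun i => x i ω) (n + 1)} := by
  have hu : {ω | Quiet θ (fun i => x i ω) 0} = Set.univ := by
    ext ω; simp [quiet_zero]
  rw [meanAlarm, tsum_eq_zero_add' ENNReal.summable, hu, measure_univ]

end AlarmTime

/-! ### The channel estimate as signal plus Gaussian noise. -/

section ChannelModel

variable {Mt Mr T : ℕ}

/-- The matrix by which the noise enters the vectorized channel estimate. -/
noncomputable def noiseGain (Mr : ℕ) (ρ : ℝ) (X : Matrix (Fin T) (Fin Mt) ℂ) :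
    Matrix (Fin Mr × Fin Mt) (Fin Mr × Fin T) ℂ :=
  ((Mt : ℂ) / ((Real.sqrt ρ : ℂ) * (T : ℂ))) • (kroneckerMap (· * ·) (1 : Matrix (Fin Mr) (Fin Mr) ℂ) Xᴴ)

lemma channelEstimate_received {ρ : ℝ} (hρ : 0 < ρ) (hMt : Mt ≠ 0) (hT : T ≠ 0)
    {X : Matrix (Fin T) (Fin Mt) ℂ} (hX : Xᴴ * X = ((T : ℂ) / (Mt : ℂ)) • 1)
    (H : Matrix (Fin Mt) (Fin Mr) ℂ) (N : Matrix (Fin T) (Fin Mr) ℂ) :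
    channelEstimate ρ X (received ρ X H N) = H.vec + noiseGain Mr ρ X *ᵥ N.vec := by
  have hs : (Real.sqrt ρ : ℂ) ≠ 0 := by
    simpa using (Real.sqrt_pos.2 hρ).ne'
  have h1 : (Mt : ℂ) ≠ 0 := by exact_mod_cast hMt
  have h2 : (T : ℂ) ≠ 0 := by exact_mod_cast hT
  rw [channelEstimate, received, noiseGain, smul_mulVec, kronecker_mulVec_vec, Matrix.mul_add,
    Matrix.mul_smul, ← Matrix.mul_assoc, hX, smul_add, vec_add, transpose_one, Matrix.mul_one,
    vec_smul _ (Xᴴ * N), Matrix.smul_mul, Matrix.one_mul, smul_smul, smul_smul]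
  congr 1
  have : (Mt : ℂ) / ((Real.sqrt ρ : ℂ) * (T : ℂ)) * ((Real.sqrt ρ : ℂ) * ((T : ℂ) / (Mt : ℂ))) = 1 := by
    field_simp
  rw [mul_assoc, this, one_smul]

/-- The constant is (Mt / (√ρ T))² · (T / Mt) = Mt / (ρ T) = 1 / E₀, the second factor coming from
`Xᴴ * X`. -/
lemma noiseGain_mul {ρ : ℝ} (hρ : 0 < ρ) (hMt : Mt ≠ 0) (hT : T ≠ 0)
    {X : Matrix (Fin T) (Fin Mt) ℂ} (hX : Xᴴ * X = ((T : ℂ) / (Mt : ℂ)) • 1) (σ : ℝ) :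
    noiseGain Mr ρ X * (((σ ^ 2 : ℝ) : ℂ) • (1 : Matrix (Fin Mr × Fin T) (Fin Mr × Fin T) ℂ)) *
        (noiseGain Mr ρ X)ᴴ =
      ((σ ^ 2 / pilotEnergy ρ T Mt : ℝ) : ℂ) • 1 := by
  have hs : (Real.sqrt ρ : ℂ) ≠ 0 := by
    simpa using (Real.sqrt_pos.2 hρ).ne'
  have hss : (Real.sqrt ρ : ℂ) ^ 2 = ρ := by
    rw [← Complex.ofReal_pow, Real.sq_sqrt hρ.le]
  have hr : (ρ : ℂ) ≠ 0 := by exact_mod_cast hρ.ne'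
  have h1 : (Mt : ℂ) ≠ 0 := by exact_mod_cast hMt
  have h2 : (T : ℂ) ≠ 0 := by exact_mod_cast hT
  have hG : kroneckerMap (· * ·) (1 : Matrix (Fin Mr) (Fin Mr) ℂ) Xᴴ *
      kroneckerMap (· * ·) (1 : Matrix (Fin Mr) (Fin Mr) ℂ) X = ((T : ℂ) / (Mt : ℂ)) • 1 := by
    rw [← mul_kronecker_mul, hX, Matrix.one_mul, kronecker_smul, one_kronecker_one]
  rw [noiseGain, conjTranspose_smul, conjTranspose_kronecker, conjTranspose_one,
    conjTranspose_conjTranspose]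
  simp only [Matrix.mul_smul, Matrix.smul_mul, Matrix.mul_one, hG, smul_smul]
  congr 1
  rw [pilotEnergy]
  have : star ((Mt : ℂ) / ((Real.sqrt ρ : ℂ) * (T : ℂ))) = (Mt : ℂ) / ((Real.sqrt ρ : ℂ) * (T : ℂ)) := by
    simp
  rw [this]
  push_cast
  field_simp
  rw [hss]
  field_simp

lemma posDef_estimateCov {ρ : ℝ} (hρ : 0 < ρ) (σ : ℝ)
    {C : Matrix (Fin Mr × Fin Mt) (Fin Mr × Fin Mt) ℂ} (hC : C.PosDef) :
    (estimateCov ρ σ T C).PosDef := by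
  refine hC.add_posSemidef (PosSemidef.one.smul ?_)
  have : 0 ≤ σ ^ 2 / pilotEnergy ρ T Mt := by unfold pilotEnergy; positivity
  exact_mod_cast this

end ChannelModel

end ChannelChange

/-! ### Reduction of the channel problem to independent log-likelihood ratios. -/

theorem theorem1 {Mt Mr T : ℕ} (hT : Mt ≤ T)
    (ρ σ : ℝ) (hρ : 0 < ρ)
    (X : Matrix (Fin T) (Fin Mt) ℂ) (hX : Xᴴ * X = ((T : ℂ) / (Mt : ℂ)) • 1)
    (C₀ C₁ : Matrix (Fin Mr × Fin Mt) (Fin Mr × Fin Mt) ℂ)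
    (hC₀ : C₀.PosDef) (hC₁ : C₁.PosDef) (hC : C₁ ≠ C₀)
    {Ω : Type*} [MeasurableSpace Ω]
    (P : WithTop ℕ+ → Measure Ω) [∀ ν, IsProbabilityMeasure (P ν)]
    (H : ℕ+ → Ω → Matrix (Fin Mt) (Fin Mr) ℂ) (N : ℕ+ → Ω → Matrix (Fin T) (Fin Mr) ℂ)
    (hHm : ∀ j, Measurable fun ω => (H j ω).vec)
    (hNm : ∀ j, Measurable fun ω => (N j ω).vec)
    (hH₀ : ∀ (ν : WithTop ℕ+) (j : ℕ+), (j : WithTop ℕ+) < ν →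
      HasLaw (fun ω => (H j ω).vec) (ChannelChange.complexGaussian C₀) (P ν))
    (hH₁ : ∀ (ν : WithTop ℕ+) (j : ℕ+), ν ≤ (j : WithTop ℕ+) →
      HasLaw (fun ω => (H j ω).vec) (ChannelChange.complexGaussian C₁) (P ν))
    (hN : ∀ (ν : WithTop ℕ+) (j : ℕ+),
      HasLaw (fun ω => (N j ω).vec)
        (ChannelChange.complexGaussian (((σ ^ 2 : ℝ) : ℂ) • 1)) (P ν))
    (hindep : ∀ ν : WithTop ℕ+,
      iIndepFun (fun (j : ℕ+) ω => ((H j ω).vec, (N j ω).vec)) (P ν))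
    (hHN : ∀ (ν : WithTop ℕ+) (j : ℕ+),
      IndepFun (fun ω => (H j ω).vec) (fun ω => (N j ω).vec) (P ν)) :
    (∀ θ : ℝ, 0 ≤ θ →
      (∀ᵐ ω ∂(P ⊤), ChannelChange.genieAlarmTime ρ σ X C₀ C₁ H N θ ω < ⊤) ∧
      ChannelChange.falseAlarmRate P (ChannelChange.genieAlarmTime ρ σ X C₀ C₁ H N θ) ≠ 0 ∧
      ChannelChange.condAvgDelay P (ChannelChange.genieAlarmTime ρ σ X C₀ C₁ H N θ) ≠ ⊤ ∧
      IsGreatest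
        (Set.range
          (ChannelChange.delayAt P (ChannelChange.genieAlarmTime ρ σ X C₀ C₁ H N θ)))
        (ChannelChange.condAvgDelay P (ChannelChange.genieAlarmTime ρ σ X C₀ C₁ H N θ))) ∧
    Tendsto
      (fun θ : ℝ =>
        (ChannelChange.condAvgDelay P
            (ChannelChange.genieAlarmTime ρ σ X C₀ C₁ H N θ)).toReal /
          (-Real.log
            (ChannelChange.falseAlarmRate P
              (ChannelChange.genieAlarmTime ρ σ X C₀ C₁ H N θ)).toReal))
      atTop
      (𝓝 (1 / ChannelChange.logDetDiv (ChannelChange.estimateCov ρ σ T C₁)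
        (ChannelChange.estimateCov ρ σ T C₀))) := by
  -- With `Mt = 0` the covariance matrices would have an empty index set and coincide.
  have hne : Mt ≠ 0 := by
    rintro rfl
    exact hC (Matrix.ext fun i => i.2.elim0)
  have hT0 : T ≠ 0 := by omega
  set A₀ := ChannelChange.estimateCov ρ σ T C₀ with hA₀def
  set A₁ := ChannelChange.estimateCov ρ σ T C₁ with hA₁def
  have hA₀ : A₀.PosDef := ChannelChange.posDef_estimateCov hρ σ hC₀
  have hA₁ : A₁.PosDef := ChannelChange.posDef_estimateCov hρ σ hC₁
  have hA : A₁ ≠ A₀ := fun h => hC (add_right_cancel h)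
  set B := ChannelChange.noiseGain Mr ρ X with hB
  have hBB := ChannelChange.noiseGain_mul (Mr := Mr) hρ hne hT0 hX σ
  have hllr := ChannelChange.measurable_llr A₀ A₁
  -- Each ratio is one fixed measurable function of the pair (channel, noise), so independence over
  -- time passes to the ratios by composition.
  set g : (Fin Mr × Fin Mt → ℂ) × (Fin Mr × Fin T → ℂ) → ℝ :=
    fun p => ChannelChange.llr A₀ A₁ (p.1 + B *ᵥ p.2) with hg
  have hgm : Measurable g := hllr.comp
    (measurable_fst.add ((ChannelChange.measurable_mulVec B).comp measurable_snd))
  set x : ℕ → Ω → ℝ := fun k ω => g ((H k.succPNat ω).vec, (N k.succPNat ω).vec) with hx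
  have hxm : ∀ k, Measurable (x k) := fun k => hgm.comp ((hHm _).prodMk (hNm _))
  set μ₀ := (ChannelChange.complexGaussian A₀).map (ChannelChange.llr A₀ A₁) with hμ₀
  set μ₁ := (ChannelChange.complexGaussian A₁).map (ChannelChange.llr A₀ A₁) with hμ₁
  have hμ : μ₁ = μ₀.withDensity fun y => ENNReal.ofReal (Real.exp y) := by
    rw [hμ₁, ChannelChange.complexGaussian_eq_withDensity_exp_llr hA₀ hA₁,
      ChannelChange.map_withDensity_comp (f := fun y => ENNReal.ofReal (Real.exp y)) hllr
        (by fun_prop)]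
  have hi : Integrable id μ₁ := by
    rw [hμ₁, integrable_map_measure aestronglyMeasurable_id hllr.aemeasurable]
    exact ChannelChange.integrable_llr hA₀ hA₁ A₁
  have hmean : ∫ y, y ∂μ₁ = ChannelChange.logDetDiv A₁ A₀ := by
    rw [hμ₁, integral_map (f := fun y : ℝ => y) hllr.aemeasurable aestronglyMeasurable_id,
      ChannelChange.integral_llr hA₀ hA₁]
  have hΦ : 0 < ∫ y, y ∂μ₁ := by
    rw [hmean]
    exact ChannelChange.logDetDiv_pos hA₀ hA₁ hA
  have hind : ∀ ν, iIndepFun x (P ν) := fun ν =>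
    ((hindep ν).comp (fun _ => g) fun _ => hgm).precomp Nat.succPNat_injective
  have hlaw : ∀ (ν : WithTop ℕ+) (C : Matrix (Fin Mr × Fin Mt) (Fin Mr × Fin Mt) ℂ) (k : ℕ),
      C.PosDef → HasLaw (fun ω => (H k.succPNat ω).vec) (ChannelChange.complexGaussian C) (P ν) →
      (P ν).map (x k) = (ChannelChange.complexGaussian (ChannelChange.estimateCov ρ σ T C)).map
        (ChannelChange.llr A₀ A₁) := by
    intro ν C k hCp hHl
    have hσ : (((σ ^ 2 : ℝ) : ℂ) • (1 : Matrix (Fin Mr × Fin T) (Fin Mr × Fin T) ℂ)).PosSemidef :=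
      PosSemidef.one.smul (by exact_mod_cast sq_nonneg σ)
    have h := ChannelChange.hasLaw_add_mulVec hCp.posSemidef hσ B hHl (hN ν k.succPNat)
      (hHN ν k.succPNat)
    rw [hBB] at h
    rw [ChannelChange.estimateCov, ← h.map_eq,
      AEMeasurable.map_map_of_aemeasurable hllr.aemeasurable h.aemeasurable]
    rfl
  have h₀ : ChannelChange.IsIID x μ₀ (P ⊤) :=
    ⟨hxm, hind ⊤, fun k => hlaw ⊤ C₀ k hC₀ (hH₀ ⊤ _ (WithTop.coe_lt_top _))⟩
  -- Since `x k` is the sample at time `k + 1`, the first sample after a change at time `m + 1` is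
  -- `x m`.
  have htail : ∀ m : ℕ, ChannelChange.IsIID (fun i => x (m + i)) μ₁ (P m.succPNat) := fun m =>
    ⟨fun _ => hxm _, (hind _).precomp (add_right_injective m), fun i =>
      hlaw _ C₁ (m + i) hC₁ (hH₁ _ _ (by
        rw [WithTop.coe_le_coe, Nat.succPNat_le_succPNat]
        exact Nat.le_add_right m i))⟩
  have h₁ : ChannelChange.IsIID x μ₁ (P (1 : ℕ+)) := by
    have h := htail 0
    simp only [zero_add] at h
    exact h
  have hτ : ∀ (θ : ℝ) (ω : Ω) (n : ℕ),
      (n : ℕ∞) < ChannelChange.genieAlarmTime ρ σ X C₀ C₁ H N θ ω ↔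
        ChannelChange.Quiet θ (fun i => x i ω) n := by
    intro θ ω n
    rw [ChannelChange.genieAlarmTime, ChannelChange.natCast_lt_alarmTime]
    simp_rw [ChannelChange.channelEstimate_received hρ hne hT0 hX]
    rfl
  have hfin₀ := ChannelChange.meanAlarm_null_ne_top h₀ h₁ hμ hi hΦ
  have hfin₁ := ChannelChange.meanAlarm_alt_ne_top h₁ hi hΦ
  have hRF := fun θ => ChannelChange.falseAlarmRate_eq hxm (hτ θ) (hfin₀ θ)
  have hmax : ∀ θ (ν : ℕ+),
      ChannelChange.delayAt P (ChannelChange.genieAlarmTime ρ σ X C₀ C₁ H N θ) ν ≤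
      ChannelChange.delayAt P (ChannelChange.genieAlarmTime ρ σ X C₀ C₁ H N θ) 1 := by
    intro θ ν
    rw [ChannelChange.delayAt_one_eq hxm (hτ θ), ← PNat.succPNat_natPred ν]
    exact ChannelChange.delayAt_succPNat_le (hτ θ) h₁ (hind _) (htail _)
  have hTC : ∀ θ, ChannelChange.condAvgDelay P
      (ChannelChange.genieAlarmTime ρ σ X C₀ C₁ H N θ) =
      ChannelChange.delayAt P (ChannelChange.genieAlarmTime ρ σ X C₀ C₁ H N θ) 1 := fun θ =>
    le_antisymm (iSup_le (hmax θ)) (le_iSup (ChannelChange.delayAt P _) 1)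
  have hsum : ∀ θ, ChannelChange.meanAlarm x (P (1 : ℕ+)) θ =
      1 + ChannelChange.delayAt P (ChannelChange.genieAlarmTime ρ σ X C₀ C₁ H N θ) 1 := by
    intro θ
    rw [ChannelChange.delayAt_one_eq hxm (hτ θ), ChannelChange.meanAlarm_eq_one_add]
  have hdelay : ∀ θ,
      ChannelChange.delayAt P (ChannelChange.genieAlarmTime ρ σ X C₀ C₁ H N θ) 1 ≠ ⊤ := by
    intro θ h
    exact hfin₁ θ (by rw [hsum, h, add_top])
  refine ⟨fun θ _ => ⟨ChannelChange.ae_alarm_lt_top hxm (hτ θ) (hfin₀ θ), ?_, ?_, ?_, ?_⟩, ?_⟩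
  · rw [hRF]
    exact ENNReal.inv_ne_zero.2 (hfin₀ θ)
  · rw [hTC]
    exact hdelay θ
  · exact ⟨1, (hTC θ).symm⟩
  · rintro _ ⟨ν, rfl⟩
    exact le_iSup (ChannelChange.delayAt P _) ν
  · have h := ChannelChange.tendsto_delay_div_log_meanAlarm h₀ h₁ hμ hi hΦ
    rw [hmean] at h
    refine h.congr fun θ => ?_
    rw [hRF, hTC, hsum, ENNReal.toReal_add ENNReal.one_ne_top (hdelay θ), ENNReal.toReal_one,
      ENNReal.toReal_inv, Real.log_inv, neg_neg, add_sub_cancel_left]
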